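/- Let $D$ be a probability distribution on a measurable space $\Xi$ and consider $$\min_{x\in\mathbb{R}^n}\ \psi(x):=f(x)+\varphi(x),\qquad f(x)=\mathbb{E}_{\xi\sim D}[f(x,\xi)],$$ where $\varphi:\mathbb{R}^n\to(-\infty,\infty]$ is proper, lower semicontinuous and weakly convex, $U$ is an open convex set containing $\operatorname{dom}\varphi=\{x:\varphi(x)<\infty\}$, $f(x,\cdot)$ is $D$-integrable for every $x\in U$, $f$ is weakly convex on $U$, and $\psi$ is bounded from below on $\operatorname{dom}\varphi$. (A function $h$ is $\rho$-weakly convex if $h+\frac{\rho}{2}\|\cdot\|^2$ is convex on $\operatorname{dom}h$, and weakly convex if this holds for some $\rho$.) Let $(x,y,\xi)\mapsto f_x(y,\xi)\in\mathbb{R}$ be a model function that is jointly measurable on $U\times U\times\Xi$, with $f_x(y,\cdot)$ integrable with respect to $D$ for all $x,y\in U$, and suppose that there are constants $\tau,\eta\in\mathbb{R}$, ${\sf L}>0$, ${\sf L}_\varphi\ge 0$ such that 1. $\mathbb{E}_\xi[f_x(x,\xi)]=f(x)$ for all $x\in U$, and $\mathbb{E}_\xi[f_x(y,\xi)-f(y)]\le\frac{\tau}{2}\|x-y\|^2$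 for all $x,y\in U$; 2. for every $x\in U$ and almost every $\xi$, the function $y\mapsto f_x(y,\xi)+\varphi(y)$ is $\eta$-weakly convex; 3. for all $x,y\in U$ and almost every $\xi$, $f_x(x,\xi)-f_x(y,\xi)\le{\sf L}\|x-y\|$; 4. $\varphi$ is ${\sf L}_\varphi$-Lipschitz continuous on $\operatorname{dom}\varphi$; 5. the step sizes $\alpha_k>0$ satisfy $\sum_{k=0}^\infty\alpha_k=\infty$ and $\sum_{k=0}^\infty\alpha_k^2<\infty$. Let $\xi^0,\xi^1,\dots$ be independent random variables with distribution $D$, let $\mathcal{F}_k=\sigma(\xi^0,\dots,\xi^{k-1})$ ($\mathcal{F}_0$ is trivial), and let $\{x^k\}_{k\ge0}$ be generated by the stochastic model-based method: each $x^k$ is $\mathcal{F}_k$-measurable, $x^0\in U$, and for every $k$, almost surely, $$x^{k+1}\in\operatorname*{argmin}_{x\in\mathbb{R}^n}\ f_{x^k}(x,\xi^k)+\varphi(x)+\frac{1}{2\alpha_k}\|x-x^k\|^2 .$$ Let $\theta>0$ with $\theta(\tau+\eta)<1$. Then the Moreau envelope $\mathrm{env}_{\theta\psi}(x)=\min_{y\in\mathbb{R}^n}\psi(y)+\frac{1}{2\theta}\|x-y\|^2$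 is well defined (the minimum is finite and attained for every $x\in\mathbb{R}^n$) and differentiable on $\mathbb{R}^n$, the random variables $\|\nabla\mathrm{env}_{\theta\psi}(x^k)\|$ are integrable, and $$\lim_{k\to\infty}\mathbb{E}\big[\|\nabla\mathrm{env}_{\theta\psi}(x^k)\|\big]=0,\qquad \lim_{k\to\infty}\|\nabla\mathrm{env}_{\theta\psi}(x^k)\|=0\ \text{ almost surely.}$$ -/

import Mathlib

open MeasureTheory ProbabilityTheory Filter Topology
open scoped NNReal

/-- The effective domain `{x | h x < ∞}` of an extended-real-valued function. -/
def effDom {E : Type*} (h : E → EReal) : Set E := {x | h x < ⊤}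

/-- A proper function: it takes values in `(-∞, ∞]` and is finite somewhere. -/
def IsProperFun {E : Type*} (h : E → EReal) : Prop :=
  (∀ x, h x ≠ ⊥) ∧ (effDom h).Nonempty

/-- `ρ`-weak convexity of a real function on a set `S`:
`S` is convex and `h + (ρ / 2) ‖·‖²` is convex on `S`. -/
def WeaklyConvexOn {E : Type*} [NormedAddCommGroup E] [NormedSpace ℝ E]
    (ρ : ℝ) (S : Set E) (h : E → ℝ) : Prop :=
  ConvexOn ℝ S (fun x => h x + ρ / 2 * ‖x‖ ^ 2)

/-- `ρ`-weak convexity of a function with values in `(-∞, ∞]`: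
`h + (ρ / 2) ‖·‖²` is convex on the effective domain of `h` (which is then a convex set). -/
def WeaklyConvex {E : Type*} [NormedAddCommGroup E] [NormedSpace ℝ E]
    (ρ : ℝ) (h : E → EReal) : Prop :=
  (∀ x, h x ≠ ⊥) ∧ WeaklyConvexOn ρ (effDom h) (fun x => (h x).toReal)

/-- The function `y ↦ h y + ‖y - x‖² / (2 t)` that is minimized in a proximal step at `x`
with parameter `t`. -/
noncomputable def proxObjective {E : Type*} [NormedAddCommGroup E]
    (t : ℝ) (h : E → EReal) (x y : E) : EReal :=
  h y + ((1 / (2 * t) * ‖y - x‖ ^ 2 : ℝ) : EReal)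

/-- The Moreau envelope `env_{t h}(x) = inf_y (h y + ‖x - y‖² / (2 t))`, as a real number
(this is the infimum itself whenever the infimum is finite). -/
noncomputable def moreauEnv {E : Type*} [NormedAddCommGroup E]
    (t : ℝ) (h : E → EReal) (x : E) : ℝ :=
  (⨅ y, proxObjective t h x y).toReal

/-- The objective `ψ(x) = 𝔼_{s ∼ D}[F(x, s)] + φ(x)`. -/
noncomputable def compositeObjective {E Ξ : Type*} [MeasurableSpace Ξ]
    (D : Measure Ξ) (F : E → Ξ → ℝ) (φ : E → EReal) (x : E) : EReal :=
  ((∫ s, F x s ∂D : ℝ) : EReal) + φ x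

/-- The σ-algebra `σ(ξ⁰, …, ξᵏ⁻¹)` generated by the first `k` samples (trivial for `k = 0`). -/
abbrev sampleHistory {Ω Ξ : Type*} [MeasurableSpace Ξ] (ξ : ℕ → Ω → Ξ) (k : ℕ) :
    MeasurableSpace Ω :=
  ⨆ i : Fin k, MeasurableSpace.comap (ξ i) inferInstance

/-!
Averaging the models of `f + φ`, which are `η`-weakly convex and accurate up to `(τ / 2) ‖x - y‖²`
from above, shows that `ψ = f + φ` is `(τ + η)`-weakly convex on `dom φ`. Hence for
`θ (τ + η) < 1` the proximal map `p` of `ψ` is single-valued and Lipschitz, and the Moreau envelope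
is differentiable with gradient `(z - p z) / θ`.

Comparing `x^{k+1}` with `p (x^k)` in the model, in expectation, turns the envelope into a Lyapunov
function: with `w_k² = 𝔼 ‖x^k - p (x^k)‖²` its decrease is at least a multiple of `α_k w_k²` up to
an error `O(α_k²)`, so `∑ α_k w_k² < ∞` and, almost surely, `∑ α_k ‖x^k - p (x^k)‖² < ∞`. The
steps have length `O(α_k)`, as have the increments of `d_k = ‖x^k - p (x^k)‖` and of `𝔼 d_k`.
A sequence `d` with `∑ α_k d_k² < ∞` and increments `O(α_k)` converges in absolute value, because
the increments of `d³` are `O(α_k d_k² + α_k²)`, and `∑ α_k = ∞` makes its limit `0`.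

The point `x^{k+1}` depends on the sample `ξ^k`, so the almost sure Lipschitz bound on the models is
needed simultaneously at all points of `dom φ`; by convexity it suffices to test it on a countable
set.
-/

/-! ### Real sequences -/

theorem summable_of_eventually_descent {e a c : ℕ → ℝ} {b : ℝ} (he : ∀ k, b ≤ e k)
    (ha : ∀ k, 0 ≤ a k) (hc : Summable c) (h : ∀ᶠ k in atTop, e (k + 1) ≤ e k - a k + c k) :
    Summable a := by
  obtain ⟨K, hK⟩ := eventually_atTop.1 h
  have htelescope : ∀ m, ∑ k ∈ Finset.range m, a (k + K)
      ≤ e K - e (m + K) + ∑ k ∈ Finset.range m, c (k + K) := fun m => by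
    induction m with
    | zero => simp
    | succ m ih =>
      have hstep := hK (m + K) (Nat.le_add_left K m)
      rw [Finset.sum_range_succ, Finset.sum_range_succ, Nat.add_right_comm m 1 K]
      linarith
  obtain ⟨B, hB⟩ := ((summable_nat_add_iff K).2 hc).hasSum.tendsto_sum_nat.bddAbove_range
  refine (summable_nat_add_iff K).1 <|
    summable_of_sum_range_le (c := e K - b + B) (fun k => ha (k + K)) fun m => ?_
  have hcB : ∑ k ∈ Finset.range m, c (k + K) ≤ B := hB ⟨m, rfl⟩
  linarith [htelescope m, he (m + K)]

theorem sub_le_of_relaxed_contraction {t A B X d : ℝ} (hA : 0 ≤ A) (hB : 0 ≤ B)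
    (ht : -(1 / 2) ≤ t ∧ t ≤ 1 / 2) (h : (1 - t) * X ≤ (1 - t) * d - 2 * A + B) :
    X - d ≤ -(4 / 3 * A) + 2 * B := by
  refine le_of_mul_le_mul_left (?_ : (1 - t) * _ ≤ (1 - t) * _) (by linarith)
  nlinarith

theorem abs_pow_three_sub_pow_three_le (a b : ℝ) :
    |b ^ 3 - a ^ 3| ≤ |b - a| * (9 / 2 * a ^ 2 + 5 / 2 * |b - a| ^ 2) := by
  have hfactor : b ^ 3 - a ^ 3 = (b - a) * (b ^ 2 + b * a + a ^ 2) := by ring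
  rw [hfactor, abs_mul, sq_abs]
  refine mul_le_mul_of_nonneg_left (abs_le.2 ⟨?_, ?_⟩) (abs_nonneg _)
  · nlinarith [sq_nonneg (b + a), sq_nonneg (b - a), sq_nonneg a]
  · nlinarith [sq_nonneg (2 * a - b)]

theorem eventually_le_one_of_summable_sq {α : ℕ → ℝ} (h : Summable fun k => α k ^ 2) :
    ∀ᶠ k in atTop, α k ≤ 1 := by
  filter_upwards [h.tendsto_atTop_zero.eventually_le_const one_pos] with k hk
  exact (le_abs_self _).trans ((sq_le_one_iff_abs_le_one _).1 hk)

theorem eventually_abs_mul_le_half_of_summable_sq {α : ℕ → ℝ} (h : Summable fun k => α k ^ 2)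
    (c : ℝ) : ∀ᶠ k in atTop, |α k * c| ≤ 1 / 2 := by
  have hlim := (h.mul_right (c ^ 2)).tendsto_atTop_zero
  filter_upwards [hlim.eventually_le_const (by positivity : (0 : ℝ) < (1 / 2) ^ 2)] with k hk
  exact abs_le_of_sq_le_sq (by rwa [mul_pow]) one_half_pos.le

theorem exists_tendsto_abs_of_summable_mul_sq {α w : ℕ → ℝ} {C : ℝ} (hα : ∀ k, 0 ≤ α k)
    (hα_sq : Summable fun k => α k ^ 2) (hsum : Summable fun k => α k * w k ^ 2)
    (hinc : ∀ᶠ k in atTop, |w (k + 1) - w k| ≤ C * α k) :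
    ∃ r, Tendsto (fun k => |w k|) atTop (𝓝 r) := by
  suffices hcube : Summable fun k => dist (w k ^ 3) (w (k + 1) ^ 3) by
    obtain ⟨l, hl⟩ := cauchySeq_tendsto_of_complete (cauchySeq_of_summable_dist hcube)
    refine ⟨|l| ^ ((3 : ℕ) : ℝ)⁻¹, (hl.abs.rpow_const (Or.inr (by norm_num))).congr fun k => ?_⟩
    rw [abs_pow, Real.pow_rpow_inv_natCast (abs_nonneg _) three_ne_zero]
  refine Summable.of_norm_bounded_eventually_nat
    (((hsum.mul_left (9 / 2)).add (hα_sq.mul_left (5 / 2 * C ^ 2))).mul_left C) ?_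
  filter_upwards [hinc, eventually_le_one_of_summable_sq hα_sq] with k hk hk1
  have hCα : 0 ≤ C * α k := (abs_nonneg _).trans hk
  have hα_le : α k ^ 2 ≤ α k := pow_le_of_le_one (hα k) hk1 two_ne_zero
  rw [Real.norm_of_nonneg dist_nonneg, dist_comm, Real.dist_eq]
  calc |w (k + 1) ^ 3 - w k ^ 3|
      ≤ |w (k + 1) - w k| * (9 / 2 * w k ^ 2 + 5 / 2 * |w (k + 1) - w k| ^ 2) :=
        abs_pow_three_sub_pow_three_le _ _
    _ ≤ C * α k * (9 / 2 * w k ^ 2 + 5 / 2 * (C * α k) ^ 2) := by gcongr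
    _ = C * (9 / 2 * (α k * w k ^ 2)) + 5 / 2 * C ^ 2 * (C * α k) * α k ^ 2 := by ring
    _ ≤ C * (9 / 2 * (α k * w k ^ 2)) + 5 / 2 * C ^ 2 * (C * α k) * α k := by gcongr
    _ = C * (9 / 2 * (α k * w k ^ 2) + 5 / 2 * C ^ 2 * α k ^ 2) := by ring

theorem tendsto_zero_of_summable_mul_sq {α w : ℕ → ℝ} {C : ℝ} (hα : ∀ k, 0 ≤ α k)
    (hα_sq : Summable fun k => α k ^ 2) (hsum : Summable fun k => α k * w k ^ 2)
    (hinc : ∀ᶠ k in atTop, |w (k + 1) - w k| ≤ C * α k)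
    (hα_sum : ¬ Summable α) : Tendsto w atTop (𝓝 0) := by
  obtain ⟨r, hr⟩ := exists_tendsto_abs_of_summable_mul_sq hα hα_sq hsum hinc
  suffices hr0 : r = 0 from (tendsto_zero_iff_abs_tendsto_zero w).2 (hr0 ▸ hr)
  by_contra hr0
  have hr_sq : 0 < r ^ 2 := by positivity
  refine hα_sum <| Summable.of_norm_bounded_eventually_nat (hsum.mul_left (2 / r ^ 2)) ?_
  filter_upwards [(hr.pow 2).eventually_const_le (half_lt_self hr_sq)] with k hk
  rw [sq_abs] at hk
  calc ‖α k‖ = 2 / r ^ 2 * (α k * (r ^ 2 / 2)) := by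
        rw [Real.norm_of_nonneg (hα k)]; field_simp
    _ ≤ 2 / r ^ 2 * (α k * w k ^ 2) := by have := hα k; gcongr

/-! ### Convex functions above continuous functions -/

section ConvexTest

variable {E : Type*} [NormedAddCommGroup E] [NormedSpace ℝ E] {C : Set E} {G l : E → ℝ}

theorem le_of_le_on_interior (hG : ConvexOn ℝ C G) (hl : ContinuousOn l C)
    (hC : (interior C).Nonempty) (h : ∀ y ∈ interior C, l y ≤ G y) : ∀ y ∈ C, l y ≤ G y := by
  obtain ⟨c, hc⟩ := hC
  intro y hy
  let p : ℝ → E := fun t => (1 - t) • y + t • c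
  have hp : Continuous p := by fun_prop
  have hp0 : p 0 = y := by simp [p]
  have hpC : ∀ t ∈ Set.Ioc (0 : ℝ) 1, p t ∈ interior C := fun t ht =>
    hG.1.combo_self_interior_mem_interior hy hc (sub_nonneg.2 ht.2) ht.1 (sub_add_cancel 1 t)
  have hle : ∀ t ∈ Set.Ioc (0 : ℝ) 1, l (p t) ≤ (1 - t) * G y + t * G c := fun t ht =>
    (h _ (hpC t ht)).trans <|
      hG.2 hy (interior_subset hc) (sub_nonneg.2 ht.2) ht.1.le (sub_add_cancel 1 t)
  have hmem : ∀ᶠ t in 𝓝[>] (0 : ℝ), t ∈ Set.Ioc (0 : ℝ) 1 := Ioc_mem_nhdsGT one_pos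
  have hp_lim : Tendsto p (𝓝[>] 0) (𝓝[C] y) :=
    tendsto_nhdsWithin_iff.2 ⟨(hp.tendsto' 0 y hp0).mono_left nhdsWithin_le_nhds,
      hmem.mono fun t ht => interior_subset (hpC t ht)⟩
  have hG_lim : Tendsto (fun t => (1 - t) * G y + t * G c) (𝓝[>] 0) (𝓝 (G y)) := by
    have hcont : Continuous fun t : ℝ => (1 - t) * G y + t * G c := by fun_prop
    exact (hcont.tendsto' 0 (G y) (by simp)).mono_left nhdsWithin_le_nhds
  exact le_of_tendsto_of_tendsto ((hl y hy).tendsto.comp hp_lim) hG_lim (hmem.mono hle)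

theorem exists_countable_test_of_interior_nonempty [FiniteDimensional ℝ E]
    (hC : (interior C).Nonempty) :
    ∃ Q ⊆ C, Q.Countable ∧ ∀ G l : E → ℝ, ConvexOn ℝ C G → ContinuousOn l C →
      (∀ q ∈ Q, l q ≤ G q) → ∀ y ∈ C, l y ≤ G y := by
  obtain ⟨Q, hQC, hQ, hdense⟩ :=
    (TopologicalSpace.IsSeparable.of_separableSpace (interior C)).exists_countable_dense_subset
  refine ⟨Q, hQC.trans interior_subset, hQ, fun G l hG hl hle =>
    le_of_le_on_interior hG hl hC fun y hy => ?_⟩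
  exact ContinuousWithinAt.closure_le (hdense hy)
    ((hl y (interior_subset hy)).mono (hQC.trans interior_subset))
    ((hG.continuousOn_interior y hy).mono hQC) hle

theorem exists_affineMap_preimage_interior_nonempty [FiniteDimensional ℝ E] (hC : Convex ℝ C)
    (hne : C.Nonempty) :
    ∃ (V : Submodule ℝ E) (g : V →ᵃ[ℝ] E), C ⊆ Set.range g ∧ (interior (g ⁻¹' C)).Nonempty := by
  obtain ⟨a, ha⟩ := hne
  let V := vectorSpan ℝ C
  let g : V →ᵃ[ℝ] E := V.subtype.toAffineMap + AffineMap.const ℝ V a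
  have hg : ∀ v : V, g v = v + a := fun v => rfl
  have hCg : C ⊆ Set.range g := fun y hy =>
    ⟨⟨y - a, vsub_mem_vectorSpan ℝ hy ha⟩, by simp [hg]⟩
  refine ⟨V, g, hCg, ?_⟩
  have h0 : (0 : V) ∈ g ⁻¹' C := by simpa [hg] using ha
  rw [(hC.affine_preimage g).interior_nonempty_iff_affineSpan_eq_top,
    AffineSubspace.affineSpan_eq_top_iff_vectorSpan_eq_top_of_nonempty ℝ V V ⟨0, h0⟩]
  refine Submodule.map_injective_of_injective V.injective_subtype ?_
  have hlinear : g.linear = V.subtype := by simp [g]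
  rw [← hlinear, AffineMap.map_vectorSpan, Set.image_preimage_eq_of_subset hCg, hlinear,
    Submodule.map_subtype_top]

theorem exists_countable_test [FiniteDimensional ℝ E] (hC : Convex ℝ C) (hne : C.Nonempty) :
    ∃ Q ⊆ C, Q.Countable ∧ ∀ G l : E → ℝ, ConvexOn ℝ C G → ContinuousOn l C →
      (∀ q ∈ Q, l q ≤ G q) → ∀ y ∈ C, l y ≤ G y := by
  obtain ⟨V, g, hCg, hint⟩ := exists_affineMap_preimage_interior_nonempty hC hne
  obtain ⟨Q, hQC, hQ, htest⟩ := exists_countable_test_of_interior_nonempty hint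
  refine ⟨g '' Q, Set.image_subset_iff.2 hQC, hQ.image g, fun G l hG hl hle y hy => ?_⟩
  obtain ⟨v, rfl⟩ := hCg hy
  exact htest (G ∘ g) (l ∘ g) (hG.comp_affineMap g)
    (hl.comp g.continuous_of_finiteDimensional.continuousOn (Set.mapsTo_preimage g C))
    (fun q hq => hle _ (Set.mem_image_of_mem g hq)) v hy

end ConvexTest

/-! ### Weak convexity and proximal points -/

section Prox

variable {E : Type*} [NormedAddCommGroup E]

/-- The real-valued counterpart of `proxObjective`, for the restriction of an extended-real-valued
function to its effective domain. -/
noncomputable def proxValue (t : ℝ) (h : E → ℝ) (z y : E) : ℝ :=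
  h y + 1 / (2 * t) * ‖y - z‖ ^ 2

/-- `p` is a proximal point of `z` with parameter `t` for the function that equals `h` on `C` and
`∞` elsewhere. -/
def IsProxPoint (t : ℝ) (C : Set E) (h : E → ℝ) (z p : E) : Prop :=
  p ∈ C ∧ IsMinOn (proxValue t h z) C p

/-- `p` is a selection of proximal points; under strong convexity it is the proximal map. -/
def IsProxMap (t : ℝ) (C : Set E) (h : E → ℝ) (p : E → E) : Prop :=
  ∀ z, IsProxPoint t C h z (p z)

theorem IsProxPoint.congr {t : ℝ} {C : Set E} {h h' : E → ℝ} {z p : E}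
    (hp : IsProxPoint t C h z p) (heq : Set.EqOn h h' C) : IsProxPoint t C h' z p :=
  ⟨hp.1, fun y hy => by simpa only [proxValue, Set.mem_ofPred_eq, heq hy, heq hp.1] using hp.2 hy⟩

theorem le_proxValue {h : E → ℝ} {t b : ℝ} {z y : E} (ht : 0 < t) (hb : b ≤ h y) :
    b ≤ proxValue t h z y :=
  hb.trans (le_add_of_nonneg_right (by positivity))

theorem IsProxMap.two_mul_proxValue_sub_le {θ : ℝ} {C : Set E} {h : E → ℝ} {p : E → E}
    (hp : IsProxMap θ C h p) (hθ : 0 < θ) (z w : E) :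
    2 * θ * (proxValue θ h w (p w) - proxValue θ h z (p z)) ≤ ‖w - p z‖ ^ 2 - ‖z - p z‖ ^ 2 := by
  rw [norm_sub_rev w, norm_sub_rev z]
  calc 2 * θ * (proxValue θ h w (p w) - proxValue θ h z (p z))
      ≤ 2 * θ * (proxValue θ h w (p z) - proxValue θ h z (p z)) := by
        gcongr
        exact (hp w).2 (hp z).1
    _ = ‖p z - w‖ ^ 2 - ‖p z - z‖ ^ 2 := by
        rw [proxValue, proxValue]
        field_simp
        ring

section NormedSpace

variable [NormedSpace ℝ E] {C : Set E} {h : E → ℝ} {m : ℝ}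

theorem quadratic_growth_of_le_on_segment (hh : StrongConvexOn C m h) {p y : E} (hp : p ∈ C)
    (hy : y ∈ C) {t : ℕ → ℝ} (ht : ∀ k, t k ∈ Set.Ioc 0 1) (ht_lim : Tendsto t atTop (𝓝 0))
    (hmin : ∀ k, h p ≤ h ((1 - t k) • p + t k • y)) : h p + m / 2 * ‖p - y‖ ^ 2 ≤ h y := by
  have hle : ∀ k, h p + (1 - t k) * (m / 2 * ‖p - y‖ ^ 2) ≤ h y := fun k => by
    have hconv := hh.2 hp hy (sub_nonneg.2 (ht k).2) (ht k).1.le (sub_add_cancel 1 (t k))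
    simp only [smul_eq_mul] at hconv
    refine le_of_mul_le_mul_left ?_ (ht k).1
    linarith [hmin k]
  have hlim : Tendsto (fun k => h p + (1 - t k) * (m / 2 * ‖p - y‖ ^ 2)) atTop
      (𝓝 (h p + (1 - 0) * (m / 2 * ‖p - y‖ ^ 2))) :=
    ((ht_lim.const_sub 1).mul_const _).const_add _
  simpa using le_of_tendsto' hlim hle

theorem exists_seq_mem_Ioc_tendsto_zero :
    ∃ t : ℕ → ℝ, (∀ k, t k ∈ Set.Ioc (0 : ℝ) 1) ∧ Tendsto t atTop (𝓝 0) := by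
  obtain ⟨t, -, ht, ht_lim⟩ := exists_seq_strictAnti_tendsto' (zero_lt_one (α := ℝ))
  exact ⟨t, fun k => Set.Ioo_subset_Ioc_self (ht k), ht_lim⟩

theorem quadratic_growth_of_isMinOn (hh : StrongConvexOn C m h) {p y : E} (hp : p ∈ C)
    (hmin : IsMinOn h C p) (hy : y ∈ C) : h p + m / 2 * ‖p - y‖ ^ 2 ≤ h y := by
  obtain ⟨t, ht, ht_lim⟩ := exists_seq_mem_Ioc_tendsto_zero
  exact quadratic_growth_of_le_on_segment hh hp hy ht ht_lim fun k =>
    hmin (hh.1 hp hy (sub_nonneg.2 (ht k).2) (ht k).1.le (sub_add_cancel 1 (t k)))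

end NormedSpace

variable [InnerProductSpace ℝ E] {C : Set E} {h : E → ℝ} {θ ρ : ℝ} {p : E → E}

theorem WeaklyConvexOn.strongConvexOn_proxValue (hh : WeaklyConvexOn ρ C h) (t : ℝ) (z : E) :
    StrongConvexOn C (1 / t - ρ) (proxValue t h z) := by
  have haffine : ConvexOn ℝ C fun y => (-(1 / t) • innerₛₗ ℝ z) y + 1 / (2 * t) * ‖z‖ ^ 2 :=
    ((-(1 / t) • innerₛₗ ℝ z).convexOn hh.1).add_const _
  refine strongConvexOn_iff_convex.2 ((hh.add haffine).congr fun y _ => ?_)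
  simp only [proxValue, Pi.add_apply, LinearMap.smul_apply, innerₛₗ_apply_apply, smul_eq_mul,
    norm_sub_sq_real, real_inner_comm z y]
  ring

theorem exists_isProxMap [FiniteDimensional ℝ E] {b : ℝ} (hθ : 0 < θ)
    (hC : IsClosed C) (hne : C.Nonempty) (hh : ContinuousOn h C) (hb : ∀ y ∈ C, b ≤ h y) :
    ∃ p, IsProxMap θ C h p := by
  suffices hex : ∀ z, ∃ q ∈ C, IsMinOn (proxValue θ h z) C q by
    choose p hp using hex
    exact ⟨p, hp⟩
  intro z
  obtain ⟨c, hc⟩ := hne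
  have hcont : ContinuousOn (proxValue θ h z) C := by unfold proxValue; fun_prop
  have hcoercive : Tendsto (fun y => b + 1 / (2 * θ) * ‖y - z‖ ^ 2) (cocompact E) atTop := by
    refine tendsto_atTop_add_const_left _ _ (Tendsto.const_mul_atTop (by positivity) ?_)
    exact (tendsto_pow_atTop two_ne_zero).comp <|
      (tendsto_norm_cocompact_atTop (E := E)).comp
        (Homeomorph.subRight z).isClosedEmbedding.tendsto_cocompact
  refine hcont.exists_isMinOn' hC hc (Filter.eventually_inf_principal.2 ?_)
  filter_upwards [hcoercive.eventually_ge_atTop (proxValue θ h z c)] with y hy hyC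
  exact hy.trans (add_le_add_left (hb y hyC) _)

theorem IsProxPoint.quadratic_growth {z q y : E} (hq : IsProxPoint θ C h z q)
    (hh : WeaklyConvexOn ρ C h) (hy : y ∈ C) :
    proxValue θ h z q + (1 / θ - ρ) / 2 * ‖q - y‖ ^ 2 ≤ proxValue θ h z y :=
  quadratic_growth_of_isMinOn (hh.strongConvexOn_proxValue θ z) hq.1 hq.2 hy

theorem IsProxMap.mul_norm_sub_sq_le (hp : IsProxMap θ C h p) (hh : WeaklyConvexOn ρ C h)
    (hθ : 0 < θ) (z w : E) :
    (1 - θ * ρ) * ‖p z - p w‖ ^ 2 ≤ inner ℝ (p z - p w) (z - w) := by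
  have hz := (hp z).quadratic_growth hh (hp w).1
  have hw := (hp w).quadratic_growth hh (hp z).1
  rw [norm_sub_rev (p w) (p z)] at hw
  have hcross : ‖p w - z‖ ^ 2 - ‖p z - z‖ ^ 2 + (‖p z - w‖ ^ 2 - ‖p w - w‖ ^ 2)
      = 2 * inner ℝ (p z - p w) (z - w) := by
    simp only [norm_sub_sq_real, inner_sub_left, inner_sub_right]
    ring
  have hsum : (1 / θ - ρ) * ‖p z - p w‖ ^ 2 ≤ 1 / θ * inner ℝ (p z - p w) (z - w) := by
    unfold proxValue at hz hw
    have hhalf : 1 / (2 * θ) = 1 / θ / 2 := by ring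
    rw [hhalf] at hz hw
    linear_combination hz + hw + 1 / θ / 2 * hcross
  have := mul_le_mul_of_nonneg_left hsum hθ.le
  have hθ' : θ * (1 / θ) = 1 := by field_simp
  linear_combination this + (inner ℝ (p z - p w) (z - w) - ‖p z - p w‖ ^ 2) * hθ'

theorem IsProxMap.norm_sub_le (hp : IsProxMap θ C h p) (hh : WeaklyConvexOn ρ C h) (hθ : 0 < θ)
    (hρ : θ * ρ < 1) (z w : E) : ‖p z - p w‖ ≤ (1 - θ * ρ)⁻¹ * ‖z - w‖ := by
  rw [← div_eq_inv_mul, le_div_iff₀ (sub_pos.2 hρ)]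
  rcases (norm_nonneg (p z - p w)).eq_or_lt with h0 | h0
  · simp [← h0]
  refine le_of_mul_le_mul_left ?_ h0
  calc ‖p z - p w‖ * (‖p z - p w‖ * (1 - θ * ρ)) = (1 - θ * ρ) * ‖p z - p w‖ ^ 2 := by ring
    _ ≤ inner ℝ (p z - p w) (z - w) := hp.mul_norm_sub_sq_le hh hθ z w
    _ ≤ ‖p z - p w‖ * ‖z - w‖ := real_inner_le_norm _ _

theorem IsProxMap.continuous (hp : IsProxMap θ C h p) (hh : WeaklyConvexOn ρ C h) (hθ : 0 < θ)
    (hρ : θ * ρ < 1) : Continuous p :=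
  (LipschitzWith.of_dist_le' fun z w => by
    simpa only [dist_eq_norm] using hp.norm_sub_le hh hθ hρ z w).continuous

theorem IsProxMap.proxValue_le (hp : IsProxMap θ C h p) (z w : E) :
    proxValue θ h w (p w) ≤ proxValue θ h z (p z) + inner ℝ ((1 / θ) • (z - p z)) (w - z)
      + 1 / (2 * θ) * ‖w - z‖ ^ 2 := by
  have hsq : ‖p z - w‖ ^ 2 = ‖p z - z‖ ^ 2 + 2 * inner ℝ (z - p z) (w - z) + ‖w - z‖ ^ 2 := by
    rw [norm_sub_rev (p z) z, ← norm_add_sq_real, norm_sub_rev, add_comm, sub_add_sub_cancel]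
  refine ((hp w).2 (hp z).1).trans (le_of_eq ?_)
  rw [proxValue, proxValue, hsq, real_inner_smul_left]
  ring

theorem hasGradientAt_of_abs_sub_sub_inner_le [CompleteSpace E] {f : E → ℝ} {g z : E} {c : ℝ}
    (hf : ∀ w, |f w - f z - inner ℝ g (w - z)| ≤ c * ‖w - z‖ ^ 2) : HasGradientAt f g z := by
  rw [hasGradientAt_iff_isLittleO]
  refine (Asymptotics.IsBigO.of_bound c (.of_forall fun w => ?_)).trans_isLittleO
    (Asymptotics.isLittleO_pow_sub_sub z one_lt_two)
  simpa using hf w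

theorem IsProxMap.hasGradientAt [CompleteSpace E] (hp : IsProxMap θ C h p)
    (hh : WeaklyConvexOn ρ C h) (hθ : 0 < θ) (hρ : θ * ρ < 1) (z : E) :
    HasGradientAt (fun z => proxValue θ h z (p z)) ((1 / θ) • (z - p z)) z := by
  set K := (1 - θ * ρ)⁻¹
  refine hasGradientAt_of_abs_sub_sub_inner_le (c := 1 / θ * (1 + K)) fun w => ?_
  have hupper := hp.proxValue_le z w
  have hlower := hp.proxValue_le w z
  have hlip : inner ℝ (p w - p z) (w - z) ≤ K * ‖w - z‖ ^ 2 :=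
    calc inner ℝ (p w - p z) (w - z) ≤ ‖p w - p z‖ * ‖w - z‖ := real_inner_le_norm _ _
      _ ≤ K * ‖w - z‖ * ‖w - z‖ := by gcongr; exact hp.norm_sub_le hh hθ hρ w z
      _ = K * ‖w - z‖ ^ 2 := by ring
  have hcross : inner ℝ ((1 / θ) • (w - p w)) (z - w) = -inner ℝ ((1 / θ) • (z - p z)) (w - z)
      - 1 / θ * ‖w - z‖ ^ 2 + 1 / θ * inner ℝ (p w - p z) (w - z) := by
    rw [← real_inner_self_eq_norm_sq]
    simp only [real_inner_smul_left, inner_sub_left, inner_sub_right]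
    ring
  rw [hcross, norm_sub_rev z w] at hlower
  have hsq : 0 ≤ 1 / (2 * θ) * ‖w - z‖ ^ 2 := by positivity
  have hdouble : 1 / θ * ‖w - z‖ ^ 2 = 2 * (1 / (2 * θ) * ‖w - z‖ ^ 2) := by ring
  have hK : 0 ≤ 1 / θ * (K * ‖w - z‖ ^ 2) := by
    have := sub_pos.2 hρ
    positivity
  have := mul_le_mul_of_nonneg_left hlip (one_div_nonneg.2 hθ.le)
  rw [abs_le]
  constructor <;> linarith

end Prox

/-! ### Extended-real-valued functions -/

section ExtendedReal

variable {E : Type*} {φ : E → EReal} {x : E}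

theorem eq_top_of_notMem_effDom (hx : x ∉ effDom φ) : φ x = ⊤ :=
  not_lt_top_iff.1 hx

theorem effDom_coe_add (c : E → ℝ) : effDom (fun y => (c y : EReal) + φ y) = effDom φ := by
  ext x
  refine ⟨fun hx => ?_, fun hx => EReal.add_lt_top (EReal.coe_ne_top _) hx.ne⟩
  by_contra htop
  have hlt : (c x : EReal) + φ x < ⊤ := hx
  rw [eq_top_of_notMem_effDom htop, EReal.coe_add_top] at hlt
  exact lt_irrefl _ hlt

theorem coe_add_eq_coe (hφ : ∀ x, φ x ≠ ⊥) (hx : x ∈ effDom φ) (r : ℝ) :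
    (r : EReal) + φ x = ((r + (φ x).toReal : ℝ) : EReal) := by
  rw [EReal.coe_add, EReal.coe_toReal hx.ne (hφ x)]

theorem WeaklyConvex.weaklyConvexOn_add_toReal [NormedAddCommGroup E] [NormedSpace ℝ E] {ρ : ℝ}
    {c : E → ℝ} (hφ : ∀ x, φ x ≠ ⊥) (h : WeaklyConvex ρ fun y => (c y : EReal) + φ y) :
    WeaklyConvexOn ρ (effDom φ) fun y => c y + (φ y).toReal :=
  ConvexOn.congr (effDom_coe_add c ▸ h.2) fun y hy => by
    simp only [coe_add_eq_coe hφ hy, EReal.toReal_coe]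

theorem isClosed_effDom_of_lipschitzOnWith [PseudoMetricSpace E] (hφ : ∀ x, φ x ≠ ⊥)
    (hlsc : LowerSemicontinuous φ) {K : ℝ≥0}
    (hK : LipschitzOnWith K (fun x => (φ x).toReal) (effDom φ)) : IsClosed (effDom φ) := by
  refine isClosed_of_closure_subset fun x hx => ?_
  rw [mem_closure_iff_frequently] at hx
  obtain ⟨y₀, hy₀, hdist₀⟩ := (hx.and_eventually (Metric.ball_mem_nhds x one_pos)).exists
  by_contra hcon
  have hlarge : ∀ᶠ y in 𝓝 x, (((φ y₀).toReal + K * 2 : ℝ) : EReal) < φ y :=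
    hlsc x _ ((EReal.coe_lt_top _).trans_eq (eq_top_of_notMem_effDom hcon).symm)
  obtain ⟨y, hy, hφy, hdist⟩ :=
    (hx.and_eventually (hlarge.and (Metric.ball_mem_nhds x one_pos))).exists
  rw [← EReal.coe_toReal hy.ne (hφ y), EReal.coe_lt_coe_iff] at hφy
  have hlip : (φ y).toReal ≤ (φ y₀).toReal + K * dist y y₀ := hK.le_add_mul hy hy₀
  have hdist_le : dist y y₀ ≤ 2 := by
    have := dist_triangle_right y y₀ x
    linarith [Metric.mem_ball.1 hdist, Metric.mem_ball.1 hdist₀]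
  have : (K : ℝ) * dist y y₀ ≤ K * 2 := by gcongr
  linarith

variable [NormedAddCommGroup E] {c : E → ℝ} {t : ℝ} {y z : E}

theorem proxObjective_coe_add (hφ : ∀ x, φ x ≠ ⊥) (hy : y ∈ effDom φ) :
    proxObjective t (fun y => (c y : EReal) + φ y) z y
      = (proxValue t (fun y => c y + (φ y).toReal) z y : EReal) := by
  rw [proxObjective, coe_add_eq_coe hφ hy, ← EReal.coe_add, proxValue]

theorem proxObjective_coe_add_of_notMem (hy : y ∉ effDom φ) :
    proxObjective t (fun y => (c y : EReal) + φ y) z y = ⊤ := by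
  rw [proxObjective, eq_top_of_notMem_effDom hy, EReal.coe_add_top, EReal.top_add_coe]

theorem isMinOn_proxObjective_coe_add_iff (hφ : IsProperFun φ) :
    IsMinOn (proxObjective t (fun y => (c y : EReal) + φ y) z) Set.univ y
      ↔ IsProxPoint t (effDom φ) (fun y => c y + (φ y).toReal) z y := by
  obtain ⟨hbot, x, hx⟩ := hφ
  constructor
  · intro hmin
    have hle := isMinOn_univ_iff.1 hmin
    have hy : y ∈ effDom φ := by
      by_contra hy
      have hle_x := hle x
      rw [proxObjective_coe_add hbot hx, proxObjective_coe_add_of_notMem hy, top_le_iff] at hle_x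
      exact EReal.coe_ne_top _ hle_x
    refine ⟨hy, fun w hw => ?_⟩
    have hle_w := hle w
    rwa [proxObjective_coe_add hbot hw, proxObjective_coe_add hbot hy,
      EReal.coe_le_coe_iff] at hle_w
  · rintro ⟨hy, hmin⟩
    refine isMinOn_univ_iff.2 fun w => ?_
    by_cases hw : w ∈ effDom φ
    · rw [proxObjective_coe_add hbot hw, proxObjective_coe_add hbot hy, EReal.coe_le_coe_iff]
      exact hmin hw
    · exact proxObjective_coe_add_of_notMem (c := c) hw ▸ le_top

theorem IsProxMap.moreauEnv_eq (hφ : IsProperFun φ) {p : E → E}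
    (hp : IsProxMap t (effDom φ) (fun y => c y + (φ y).toReal) p) :
    moreauEnv t (fun y => (c y : EReal) + φ y)
      = fun z => proxValue t (fun y => c y + (φ y).toReal) z (p z) := by
  ext z
  have hmin := isMinOn_univ_iff.1 ((isMinOn_proxObjective_coe_add_iff hφ).2 (hp z))
  have hinf : ⨅ y, proxObjective t (fun y => (c y : EReal) + φ y) z y
      = proxObjective t (fun y => (c y : EReal) + φ y) z (p z) :=
    le_antisymm (iInf_le _ _) (le_iInf hmin)
  rw [moreauEnv, hinf, proxObjective_coe_add hφ.1 (hp z).1, EReal.toReal_coe]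

theorem IsProxMap.hasGradientAt_moreauEnv [InnerProductSpace ℝ E] [CompleteSpace E]
    (hφ : IsProperFun φ) {p : E → E} {θ ρ : ℝ}
    (hp : IsProxMap θ (effDom φ) (fun y => c y + (φ y).toReal) p)
    (hwc : WeaklyConvexOn ρ (effDom φ) fun y => c y + (φ y).toReal) (hθ : 0 < θ) (hρ : θ * ρ < 1)
    (z : E) : HasGradientAt (moreauEnv θ fun y => (c y : EReal) + φ y) ((1 / θ) • (z - p z)) z :=
  hp.moreauEnv_eq hφ ▸ hp.hasGradientAt hwc hθ hρ z

end ExtendedReal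

/-! ### Independent sampling -/

section Sampling

variable {Ω Ξ : Type*} [MeasurableSpace Ξ]

theorem sampleHistory_zero (ξ : ℕ → Ω → Ξ) : sampleHistory ξ 0 = ⊥ :=
  iSup_of_empty _

theorem sampleHistory_eq_comap (ξ : ℕ → Ω → Ξ) (k : ℕ) :
    sampleHistory ξ k = MeasurableSpace.comap (fun ω (i : Fin k) => ξ i ω) inferInstance := by
  simp only [MeasurableSpace.pi, MeasurableSpace.comap_iSup, MeasurableSpace.comap_comp,
    Function.comp_def]

theorem sampleHistory_succ_eq_comap (ξ : ℕ → Ω → Ξ) (k : ℕ) :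
    sampleHistory ξ (k + 1)
      = MeasurableSpace.comap (fun ω => ((fun i : Fin k => ξ i ω), ξ k ω)) inferInstance := by
  have hsup : sampleHistory ξ (k + 1)
      = sampleHistory ξ k ⊔ MeasurableSpace.comap (ξ k) inferInstance :=
    le_antisymm
      (iSup_le <| Fin.lastCases le_sup_right fun i =>
        le_sup_of_le_left (le_iSup (fun i : Fin k => MeasurableSpace.comap (ξ i) _) i))
      (sup_le (iSup_le fun i =>
        le_iSup (fun i : Fin (k + 1) => MeasurableSpace.comap (ξ i) _) i.castSucc)
        (le_iSup (fun i : Fin (k + 1) => MeasurableSpace.comap (ξ i) _) (Fin.last k)))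
  rw [hsup, sampleHistory_eq_comap]
  exact (MeasurableSpace.comap_prodMk _ _).symm

variable [mΩ : MeasurableSpace Ω] {P : Measure Ω} {ξ : ℕ → Ω → Ξ}

theorem sampleHistory_le (hξ : ∀ k, Measurable (ξ k)) (k : ℕ) : sampleHistory ξ k ≤ mΩ :=
  iSup_le fun i => (hξ i).comap_le

theorem indepFun_history_sample (hξ : ∀ k, Measurable (ξ k)) (hindep : iIndepFun ξ P) (k : ℕ) :
    IndepFun (fun ω (i : Fin k) => ξ i ω) (ξ k) P := by
  have hdisj : Disjoint (Finset.range k) {k} := by simp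
  have hlast : Measurable fun g : ({k} : Finset ℕ) → Ξ => g ⟨k, Finset.mem_singleton_self k⟩ :=
    measurable_pi_apply (X := fun _ => Ξ) _
  exact (hindep.indepFun_finset (Finset.range k) {k} hdisj hξ).comp
    (φ := fun g (i : Fin k) => g ⟨i, Finset.mem_range.2 i.2⟩)
    (measurable_pi_lambda _ fun i => measurable_pi_apply _) hlast

theorem indepFun_of_measurable_sampleHistory {A : Type*} [MeasurableSpace A] {X : Ω → A} {k : ℕ}
    (hξ : ∀ k, Measurable (ξ k)) (hindep : iIndepFun ξ P) (hX : Measurable[sampleHistory ξ k] X) :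
    IndepFun X (ξ k) P := by
  rw [sampleHistory_eq_comap] at hX
  exact (IndepFun_iff_Indep _ _ _).2 <|
    indep_of_indep_of_le_left ((IndepFun_iff_Indep _ _ _).1
      (indepFun_history_sample hξ hindep k)) hX.comap_le

theorem integral_norm_le_of_neg_le {D : Measure Ξ} [IsProbabilityMeasure D] {g : Ξ → ℝ} {b l : ℝ}
    (hg : Integrable g D) (hlower : ∀ᵐ z ∂D, -l ≤ g z) (hupper : ∫ z, g z ∂D ≤ b) :
    ∫ z, ‖g z‖ ∂D ≤ b + 2 * |l| := by
  have hle : ∀ᵐ z ∂D, ‖g z‖ ≤ g z + 2 * |l| := by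
    filter_upwards [hlower] with z hz
    exact abs_le.2 ⟨by linarith [le_abs_self l], by linarith [abs_nonneg l]⟩
  calc ∫ z, ‖g z‖ ∂D ≤ ∫ z, (g z + 2 * |l|) ∂D :=
        integral_mono_ae hg.norm (hg.add (integrable_const _)) hle
    _ = ∫ z, g z ∂D + 2 * |l| := by simp [integral_add hg (integrable_const _)]
    _ ≤ b + 2 * |l| := by gcongr

variable {D : Measure Ξ} [IsProbabilityMeasure P] [SFinite D] {A : Type*} [MeasurableSpace A]
  {X : Ω → A} {s : Ω → Ξ}

theorem ae_of_forall_ae_of_indepFun (hX : Measurable X) (hs : Measurable s)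
    (hindep : IndepFun X s P) (hlaw : P.map s = D) {R : Set (A × Ξ)} (hR : MeasurableSet R)
    (hae : ∀ a, ∀ᵐ z ∂D, (a, z) ∈ R) : ∀ᵐ ω ∂P, (X ω, s ω) ∈ R := by
  refine ae_of_ae_map (hX.prodMk hs).aemeasurable ?_
  rw [hindep.map_prod_eq_prod_map_map hX.aemeasurable hs.aemeasurable, hlaw]
  exact (Measure.ae_prod_iff_ae_ae hR).2 (.of_forall hae)

/-- The relation holds for almost every sample *simultaneously* in `b ∈ C`; this is what allows
inserting a point `Y` that depends on the sample itself. -/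
theorem ae_mem_of_forall_ae [StandardBorelSpace A] [Nonempty A] {Y : Ω → A} {k : ℕ}
    (hξ : ∀ k, Measurable (ξ k)) (hindep : iIndepFun ξ P) (hlaw : P.map (ξ k) = D)
    (hX : Measurable[sampleHistory ξ k] X) (hY : Measurable[sampleHistory ξ (k + 1)] Y)
    {U C : Set A} (hU : MeasurableSet U) (hC : MeasurableSet C)
    {Q : Set (A × A × Ξ)} (hQ : MeasurableSet Q)
    (hae : ∀ a ∈ U, ∀ᵐ z ∂D, ∀ b ∈ C, (a, b, z) ∈ Q) :
    ∀ᵐ ω ∂P, X ω ∈ U → Y ω ∈ C → (X ω, Y ω, ξ k ω) ∈ Q := by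
  rw [sampleHistory_eq_comap] at hX
  rw [sampleHistory_succ_eq_comap] at hY
  obtain ⟨F, hF, rfl⟩ := hX.exists_eq_measurable_comp
  obtain ⟨G, hG, rfl⟩ := hY.exists_eq_measurable_comp
  have hF' : Measurable fun q : (Fin k → Ξ) × Ξ => F q.1 := hF.comp measurable_fst
  refine ae_of_forall_ae_of_indepFun (measurable_pi_lambda _ fun i : Fin k => hξ i) (hξ k)
    (indepFun_history_sample hξ hindep k) hlaw
    (R := {q | F q.1 ∈ U → G q ∈ C → (F q.1, G q, q.2) ∈ Q})
    ((hF' hU).imp ((hG hC).imp (hF'.prodMk (hG.prodMk measurable_snd) hQ))) fun a => ?_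
  by_cases ha : F a ∈ U
  · filter_upwards [hae _ ha] with z hz _ hb using hz _ hb
  · exact .of_forall fun z hFa => absurd hFa ha

section Integral

variable {C : Set A} {T : A → Ξ → ℝ} {B ℓ : A → ℝ}

theorem integrable_and_integral_le_of_indepFun [IsProbabilityMeasure D] (hX : Measurable X)
    (hs : Measurable s) (hindep : IndepFun X s P) (hlaw : P.map s = D)
    (hC : MeasurableSet C) (hXC : ∀ᵐ ω ∂P, X ω ∈ C)
    (hT : Measurable fun q : A × Ξ => T q.1 q.2) (hB : Measurable B) (hℓ : Measurable ℓ)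
    (hBX : Integrable (fun ω => B (X ω)) P) (hℓX : Integrable (fun ω => ℓ (X ω)) P)
    (hTi : ∀ a ∈ C, Integrable (T a) D) (hlower : ∀ a ∈ C, ∀ᵐ z ∂D, -ℓ a ≤ T a z)
    (hupper : ∀ a ∈ C, ∫ z, T a z ∂D ≤ B a) :
    Integrable (fun ω => T (X ω) (s ω)) P ∧ ∫ ω, T (X ω) (s ω) ∂P ≤ ∫ ω, B (X ω) ∂P := by
  have hmap := hindep.map_prod_eq_prod_map_map hX.aemeasurable hs.aemeasurable
  rw [hlaw] at hmap
  have : IsProbabilityMeasure (P.map X) := Measure.isProbabilityMeasure_map hX.aemeasurable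
  have hC' : ∀ᵐ a ∂P.map X, a ∈ C := (ae_map_iff hX.aemeasurable hC).2 hXC
  have hB' : Integrable B (P.map X) :=
    (integrable_map_measure hB.aestronglyMeasurable hX.aemeasurable).2 hBX
  have hℓ' : Integrable ℓ (P.map X) :=
    (integrable_map_measure hℓ.aestronglyMeasurable hX.aemeasurable).2 hℓX
  have hprod : Integrable (fun q : A × Ξ => T q.1 q.2) ((P.map X).prod D) := by
    refine (integrable_prod_iff hT.aestronglyMeasurable).2 ⟨hC'.mono hTi, ?_⟩
    refine (hB'.add (hℓ'.abs.const_mul 2)).mono' hT.norm.aestronglyMeasurable.integral_prod_right'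
      (hC'.mono fun a ha => ?_)
    rw [Real.norm_of_nonneg (integral_nonneg fun z => norm_nonneg _)]
    exact integral_norm_le_of_neg_le (hTi a ha) (hlower a ha) (hupper a ha)
  have hXs : Measurable fun ω => (X ω, s ω) := hX.prodMk hs
  refine ⟨(hmap ▸ hprod).comp_measurable hXs, ?_⟩
  calc ∫ ω, T (X ω) (s ω) ∂P = ∫ q, T q.1 q.2 ∂((P.map X).prod D) := by
        rw [← hmap, integral_map hXs.aemeasurable hT.aestronglyMeasurable]
    _ = ∫ a, ∫ z, T a z ∂D ∂P.map X := integral_prod _ hprod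
    _ ≤ ∫ a, B a ∂P.map X := integral_mono_ae hprod.integral_prod_left hB' (hC'.mono hupper)
    _ = ∫ ω, B (X ω) ∂P := integral_map hX.aemeasurable hB.aestronglyMeasurable

end Integral

end Sampling

section Integrability

variable {Ω E : Type*} [NormedAddCommGroup E] [MeasurableSpace Ω] {P : Measure Ω}

theorem integrable_norm_sub_sq {u v : Ω → E} (hu : MemLp u 2 P) (hv : MemLp v 2 P) :
    Integrable (fun ω => ‖u ω - v ω‖ ^ 2) P :=
  (hu.sub hv).integrable_norm_pow two_ne_zero

theorem sq_integral_le_integral_sq [IsProbabilityMeasure P] {g : Ω → ℝ} (hg : MemLp g 2 P) :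
    (∫ ω, g ω ∂P) ^ 2 ≤ ∫ ω, g ω ^ 2 ∂P :=
  sub_nonneg.1 (variance_eq_sub hg ▸ variance_nonneg g P)

theorem ae_summable_norm_of_summable_integral_norm {g : ℕ → Ω → E}
    (hg : ∀ k, Integrable (g k) P) (hsum : Summable fun k => ∫ ω, ‖g k ω‖ ∂P) :
    ∀ᵐ ω ∂P, Summable fun k => ‖g k ω‖ := by
  refine summable_norm_of_tsum_eLpNorm_ne_top le_rfl (fun k => (hg k).aestronglyMeasurable) ?_
  simp only [eLpNorm_one_eq_lintegral_enorm, ← ofReal_integral_norm_eq_lintegral_enorm (hg _)]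
  exact hsum.tsum_ofReal_ne_top

theorem memLp_of_measurable_bot {p : ENNReal} {X : Ω → E} [IsFiniteMeasure P]
    (hX : StronglyMeasurable[⊥] X) : MemLp X p P := by
  obtain ⟨c, rfl⟩ := stronglyMeasurable_bot_iff.1 hX
  exact memLp_const c

end Integrability

/-! ### Stochastic models -/

theorem convexOn_of_forall_exists_le_eq {E : Type*} [AddCommGroup E] [Module ℝ E] {C : Set E}
    (hC : Convex ℝ C) {f : E → ℝ}
    (h : ∀ z ∈ C, ∃ g : E → ℝ, ConvexOn ℝ C g ∧ (∀ y ∈ C, g y ≤ f y) ∧ g z = f z) :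
    ConvexOn ℝ C f := by
  refine ⟨hC, fun a ha b hb s t hs ht hst => ?_⟩
  obtain ⟨g, hg, hgf, hgz⟩ := h _ (hC ha hb hs ht hst)
  calc f (s • a + t • b) = g (s • a + t • b) := hgz.symm
    _ ≤ s • g a + t • g b := hg.2 ha hb hs ht hst
    _ ≤ s • f a + t • f b := by gcongr <;> exact hgf _ ‹_›

theorem integral_add_const_right {Ξ : Type*} [MeasurableSpace Ξ] {D : Measure Ξ}
    [IsProbabilityMeasure D] {g : Ξ → ℝ} (hg : Integrable g D) (c : ℝ) :
    ∫ s, (g s + c) ∂D = ∫ s, g s ∂D + c := by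
  rw [integral_add hg (integrable_const c), integral_const, probReal_univ, one_smul]

/-- The assumptions on the data of the problem, with the regularizer given by its effective domain
`C` and a real-valued function `φ`: one-sided models `M x y s` of `f`, whose sum with `φ` is
`η`-weakly convex. -/
structure IsStochasticModel {E Ξ : Type*} [NormedAddCommGroup E] [NormedSpace ℝ E]
    [MeasurableSpace E] [MeasurableSpace Ξ] (D : Measure Ξ) (U C : Set E) (f φ : E → ℝ)
    (M : E → E → Ξ → ℝ) (τ η L : ℝ) (Lφ : ℝ≥0) : Prop where
  measurableSet : MeasurableSet U
  subset : C ⊆ U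
  isClosed : IsClosed C
  nonempty : C.Nonempty
  measurable_reg : Measurable φ
  lipschitz_reg : LipschitzOnWith Lφ φ C
  measurable_model : Measurable fun q : E × E × Ξ => M q.1 q.2.1 q.2.2
  integrable_model : ∀ x ∈ U, ∀ y ∈ U, Integrable (M x y) D
  model_self : ∀ x ∈ U, ∫ s, M x x s ∂D = f x
  model_le : ∀ x ∈ U, ∀ y ∈ U, ∫ s, M x y s ∂D ≤ f y + τ / 2 * ‖x - y‖ ^ 2
  model_weaklyConvex : ∀ x ∈ U, ∀ᵐ s ∂D, WeaklyConvexOn η C fun y => M x y s + φ y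
  lip_nonneg : 0 ≤ L
  model_lip : ∀ x ∈ U, ∀ y ∈ U, ∀ᵐ s ∂D, M x x s - M x y s ≤ L * ‖x - y‖

namespace IsStochasticModel

section NormedSpace

variable {E Ξ : Type*} [NormedAddCommGroup E] [NormedSpace ℝ E] [MeasurableSpace E]
  [MeasurableSpace Ξ] {D : Measure Ξ} {U C : Set E} {f φ : E → ℝ} {M : E → E → Ξ → ℝ}
  {τ η L : ℝ} {Lφ : ℝ≥0}

theorem reg_sub_le (hM : IsStochasticModel D U C f φ M τ η L Lφ) {a b : E} (ha : a ∈ C)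
    (hb : b ∈ C) : φ a - φ b ≤ Lφ * ‖a - b‖ := by
  rw [sub_le_iff_le_add', ← dist_eq_norm]
  exact hM.lipschitz_reg.le_add_mul ha hb

theorem ae_neg_le_gap (hM : IsStochasticModel D U C f φ M τ η L Lφ) {a b : E} (ha : a ∈ C)
    (hb : b ∈ C) : ∀ᵐ s ∂D, -((L + Lφ) * ‖a - b‖) ≤ M a b s - M a a s + (φ b - φ a) := by
  filter_upwards [hM.model_lip a (hM.subset ha) b (hM.subset hb)] with s hs
  linarith [hM.reg_sub_le ha hb]

theorem convex [NeZero D] (hM : IsStochasticModel D U C f φ M τ η L Lφ) : Convex ℝ C := by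
  obtain ⟨c, hc⟩ := hM.nonempty
  exact (hM.model_weaklyConvex c (hM.subset hc)).exists.elim fun _ h => h.1

theorem ae_forall_model_ge [FiniteDimensional ℝ E] [NeZero D]
    (hM : IsStochasticModel D U C f φ M τ η L Lφ) {a : E} (ha : a ∈ U) :
    ∀ᵐ s ∂D, ∀ b ∈ C, M a a s - L * ‖a - b‖ ≤ M a b s := by
  obtain ⟨Q, hQC, hQ, htest⟩ := exists_countable_test hM.convex hM.nonempty
  have hlip : ∀ᵐ s ∂D, ∀ q ∈ Q, M a a s - M a q s ≤ L * ‖a - q‖ :=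
    (ae_ball_iff hQ).2 fun q hq => hM.model_lip a ha q (hM.subset (hQC hq))
  filter_upwards [hlip, hM.model_weaklyConvex a ha] with s hs hconv b hb
  have hφ := hM.lipschitz_reg.continuousOn
  have := htest _ (fun y => M a a s - L * ‖a - y‖ + φ y + η / 2 * ‖y‖ ^ 2) hconv (by fun_prop)
    (fun q hq => by linarith [hs q hq]) b hb
  linarith

theorem integral_sub_le (hM : IsStochasticModel D U C f φ M τ η L Lφ) {a b : E} (ha : a ∈ U)
    (hb : b ∈ U) : ∫ s, (M a b s - M a a s) ∂D ≤ f b - f a + τ / 2 * ‖a - b‖ ^ 2 := by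
  rw [integral_sub (hM.integrable_model a ha b hb) (hM.integrable_model a ha a ha),
    hM.model_self a ha]
  linarith [hM.model_le a ha b hb]

variable [IsProbabilityMeasure D]

theorem sub_le (hM : IsStochasticModel D U C f φ M τ η L Lφ) {a b : E} (ha : a ∈ U)
    (hb : b ∈ U) : f a - f b ≤ L * ‖a - b‖ + τ / 2 * ‖a - b‖ ^ 2 := by
  have hlip : ∫ s, (M a a s - M a b s) ∂D ≤ L * ‖a - b‖ :=
    (integral_mono_ae ((hM.integrable_model a ha a ha).sub (hM.integrable_model a ha b hb))
      (integrable_const _) (hM.model_lip a ha b hb)).trans_eq (by simp)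
  have hle := hM.integral_sub_le ha hb
  rw [← neg_le_neg_iff, ← integral_neg] at hle
  simp only [neg_sub] at hle
  linarith

theorem weaklyConvexOn_mean (hM : IsStochasticModel D U C f φ M τ η L Lφ) {z : E} (hz : z ∈ U) :
    WeaklyConvexOn η C fun y => ∫ s, M z y s ∂D + φ y := by
  have hint : ∀ y ∈ C, Integrable (M z y) D := fun y hy =>
    hM.integrable_model z hz y (hM.subset hy)
  refine (integral_convexOn_of_integrand_ae hM.convex (hM.model_weaklyConvex z hz)
    fun y hy => ?_).congr fun y hy => ?_
  · exact ((hint y hy).add (integrable_const _)).add (integrable_const _)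
  · simp only [add_assoc]
    exact integral_add_const_right (hint y hy) _

theorem continuousOn (hM : IsStochasticModel D U C f φ M τ η L Lφ) : ContinuousOn f U := by
  intro a ha
  have hbound : Tendsto (fun b => L * ‖b - a‖ + τ / 2 * ‖b - a‖ ^ 2) (𝓝[U] a) (𝓝 0) := by
    have hcont : Continuous fun b => L * ‖b - a‖ + τ / 2 * ‖b - a‖ ^ 2 := by fun_prop
    simpa using (hcont.tendsto a).mono_left nhdsWithin_le_nhds
  refine tendsto_iff_dist_tendsto_zero.2 (squeeze_zero' (.of_forall fun _ => dist_nonneg)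
    (eventually_nhdsWithin_of_forall fun b hb => ?_) hbound)
  have hab := hM.sub_le ha hb
  rw [norm_sub_rev] at hab
  exact abs_le.2 ⟨by linarith, hM.sub_le hb ha⟩

end NormedSpace

variable {E Ξ : Type*} [NormedAddCommGroup E] [InnerProductSpace ℝ E] [MeasurableSpace E]
  [MeasurableSpace Ξ] {D : Measure Ξ} [IsProbabilityMeasure D] {U C : Set E} {f φ : E → ℝ}
  {M : E → E → Ξ → ℝ} {τ η L θ : ℝ} {Lφ : ℝ≥0} {p : E → E}

theorem weaklyConvexOn_objective (hM : IsStochasticModel D U C f φ M τ η L Lφ) :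
    WeaklyConvexOn (τ + η) C fun y => f y + φ y := by
  -- At `z`, the expected model centred at `z`, corrected by an affine function, touches from below.
  refine convexOn_of_forall_exists_le_eq hM.convex fun z hz => ?_
  have haffine : ConvexOn ℝ C fun y => (τ • innerₛₗ ℝ z) y + -(τ / 2 * ‖z‖ ^ 2) :=
    ((τ • innerₛₗ ℝ z).convexOn hM.convex).add_const _
  have hsq : ∀ y, (τ • innerₛₗ ℝ z) y + -(τ / 2 * ‖z‖ ^ 2)
      = τ / 2 * ‖y‖ ^ 2 - τ / 2 * ‖z - y‖ ^ 2 := fun y => by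
    simp only [LinearMap.smul_apply, innerₛₗ_apply_apply, smul_eq_mul, norm_sub_sq_real]
    ring
  refine ⟨_, (hM.weaklyConvexOn_mean (hM.subset hz)).add haffine, fun y hy => ?_, ?_⟩
  · simp only [Pi.add_apply, hsq]
    linarith [hM.model_le z (hM.subset hz) y (hM.subset hy)]
  · simp only [Pi.add_apply, hsq, hM.model_self z (hM.subset hz), sub_self, norm_zero]
    ring

theorem exists_isProxMap [FiniteDimensional ℝ E] {b : ℝ}
    (hM : IsStochasticModel D U C f φ M τ η L Lφ) (hθ : 0 < θ) (hb : ∀ y ∈ C, b ≤ f y + φ y) :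
    ∃ p, IsProxMap θ C (fun y => f y + φ y) p :=
  _root_.exists_isProxMap hθ hM.isClosed hM.nonempty
    ((hM.continuousOn.mono hM.subset).add hM.lipschitz_reg.continuousOn) hb

theorem integral_gap_le (hM : IsStochasticModel D U C f φ M τ η L Lφ)
    (hp : IsProxMap θ C (fun y => f y + φ y) p) {a : E} (ha : a ∈ C) :
    ∫ s, (M a (p a) s - M a a s + (φ (p a) - φ a)) ∂D
      ≤ -(1 / θ - (τ + η) + η / 2) * ‖a - p a‖ ^ 2 := by
  have haU := hM.subset ha
  have hpU := hM.subset (hp a).1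
  have hgrowth := (hp a).quadratic_growth hM.weaklyConvexOn_objective ha
  have hle := hM.integral_sub_le haU hpU
  rw [integral_add_const_right (g := fun s => M a (p a) s - M a a s)
    ((hM.integrable_model a haU _ hpU).sub (hM.integrable_model a haU a haU))]
  simp only [proxValue, sub_self, norm_zero, norm_sub_rev (p a) a] at hgrowth
  have hθ : 1 / (2 * θ) = 1 / θ / 2 := by ring
  rw [hθ] at hgrowth
  linarith

end IsStochasticModel

/-! ### The stochastic model-based method -/

/-- The iterates `x` of the stochastic model-based method with steps `α` and samples `ξ`. -/
structure IsModelMethod {E Ξ Ω : Type*} [NormedAddCommGroup E] [NormedSpace ℝ E]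
    [MeasurableSpace E] [MeasurableSpace Ξ] [MeasurableSpace Ω] (D : Measure Ξ) (P : Measure Ω)
    (U C : Set E) (f φ : E → ℝ) (M : E → E → Ξ → ℝ) (τ η L : ℝ) (Lφ : ℝ≥0) (α : ℕ → ℝ)
    (ξ : ℕ → Ω → Ξ) (x : ℕ → Ω → E) : Prop
    extends IsStochasticModel D U C f φ M τ η L Lφ where
  step_pos : ∀ k, 0 < α k
  measurable_sample : ∀ k, Measurable (ξ k)
  indep : iIndepFun ξ P
  law : ∀ k, P.map (ξ k) = D
  adapted : ∀ k, Measurable[sampleHistory ξ k] (x k)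
  init_mem : ∀ᵐ ω ∂P, x 0 ω ∈ U
  step : ∀ k, ∀ᵐ ω ∂P,
    IsProxPoint (α k) C (fun y => M (x k ω) y (ξ k ω) + φ y) (x k ω) (x (k + 1) ω)

theorem norm_sub_sq_le_of_isProxPoint {E : Type*} [NormedAddCommGroup E] {C : Set E}
    {m φ : E → ℝ} {α L K : ℝ} {a q c : E} (hα : 0 < α)
    (hq : IsProxPoint α C (fun y => m y + φ y) a q) (hc : c ∈ C) (hm : m a - L * ‖a - q‖ ≤ m q)
    (hφ : φ c - φ q ≤ K * ‖c - q‖) (hK : 0 ≤ K) :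
    ‖q - a‖ ^ 2 ≤ 4 * α * (m c - m a + 1 / (2 * α) * ‖c - a‖ ^ 2 + K * ‖c - a‖)
      + 4 * α ^ 2 * (L + K) ^ 2 := by
  have hmin : proxValue α (fun y => m y + φ y) a q ≤ proxValue α (fun y => m y + φ y) a c :=
    hq.2 hc
  simp only [proxValue] at hmin
  have htri : K * ‖c - q‖ ≤ K * (‖c - a‖ + ‖q - a‖) := by
    gcongr
    rw [norm_sub_rev q a]
    exact norm_sub_le_norm_sub_add_norm_sub c a q
  rw [norm_sub_rev a q] at hm
  set r := ‖q - a‖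
  set A := m c - m a + 1 / (2 * α) * ‖c - a‖ ^ 2 + K * ‖c - a‖
  have hquad : 1 / (2 * α) * r ^ 2 ≤ A + (L + K) * r := by linarith
  have hscaled := mul_le_mul_of_nonneg_left hquad (by positivity : 0 ≤ 2 * α)
  have hcancel : 2 * α * (1 / (2 * α) * r ^ 2) = r ^ 2 := by field_simp
  nlinarith [sq_nonneg (r - 2 * α * (L + K))]

namespace IsModelMethod

section NormedSpace

variable {E Ξ Ω : Type*} [NormedAddCommGroup E] [NormedSpace ℝ E] [MeasurableSpace E]
  [MeasurableSpace Ξ] [MeasurableSpace Ω] {D : Measure Ξ} {P : Measure Ω} {U C : Set E}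
  {f φ : E → ℝ} {M : E → E → Ξ → ℝ} {τ η L : ℝ} {Lφ : ℝ≥0} {α : ℕ → ℝ} {ξ : ℕ → Ω → Ξ}
  {x : ℕ → Ω → E}

theorem succ_mem (H : IsModelMethod D P U C f φ M τ η L Lφ α ξ x) (k : ℕ) :
    ∀ᵐ ω ∂P, x (k + 1) ω ∈ C :=
  (H.step k).mono fun _ h => h.1

theorem mem_U (H : IsModelMethod D P U C f φ M τ η L Lφ α ξ x) : ∀ k, ∀ᵐ ω ∂P, x k ω ∈ U
  | 0 => H.init_mem
  | k + 1 => (H.succ_mem k).mono fun _ h => H.subset h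

theorem measurable_iterate (H : IsModelMethod D P U C f φ M τ η L Lφ α ξ x) (k : ℕ) :
    Measurable (x k) :=
  (H.adapted k).mono (sampleHistory_le H.measurable_sample k) le_rfl

theorem indepFun_iterate_sample (H : IsModelMethod D P U C f φ M τ η L Lφ α ξ x) (k : ℕ) :
    IndepFun (x k) (ξ k) P :=
  indepFun_of_measurable_sampleHistory H.measurable_sample H.indep (H.adapted k)

variable [FiniteDimensional ℝ E] [BorelSpace E] [IsProbabilityMeasure D] [IsProbabilityMeasure P]

theorem ae_mem_of_forall_ae (H : IsModelMethod D P U C f φ M τ η L Lφ α ξ x)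
    {Q : Set (E × E × Ξ)} (hQ : MeasurableSet Q) (k : ℕ)
    (hae : ∀ a ∈ U, ∀ᵐ s ∂D, ∀ b ∈ C, (a, b, s) ∈ Q) :
    ∀ᵐ ω ∂P, (x k ω, x (k + 1) ω, ξ k ω) ∈ Q := by
  filter_upwards [_root_.ae_mem_of_forall_ae H.measurable_sample H.indep (H.law k) (H.adapted k)
    (H.adapted (k + 1)) H.measurableSet H.isClosed.measurableSet hQ hae, H.mem_U k, H.succ_mem k]
    with ω hω hU hC using hω hU hC

theorem ae_model_ge (H : IsModelMethod D P U C f φ M τ η L Lφ α ξ x) (k : ℕ) :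
    ∀ᵐ ω ∂P, M (x k ω) (x k ω) (ξ k ω) - L * ‖x k ω - x (k + 1) ω‖
      ≤ M (x k ω) (x (k + 1) ω) (ξ k ω) := by
  have hM := H.measurable_model
  have hself : Measurable fun q : E × E × Ξ => M q.1 q.1 q.2.2 :=
    hM.comp (measurable_fst.prodMk (measurable_fst.prodMk measurable_snd.snd))
  exact H.ae_mem_of_forall_ae (Q := {q | M q.1 q.1 q.2.2 - L * ‖q.1 - q.2.1‖ ≤ M q.1 q.2.1 q.2.2})
    (measurableSet_le (hself.sub (by fun_prop)) hM) k fun a ha => H.ae_forall_model_ge ha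

theorem ae_norm_step_sq_le (H : IsModelMethod D P U C f φ M τ η L Lφ α ξ x) (k : ℕ) :
    ∀ᵐ ω ∂P, ∀ c ∈ C, ‖x (k + 1) ω - x k ω‖ ^ 2
      ≤ 4 * α k * (M (x k ω) c (ξ k ω) - M (x k ω) (x k ω) (ξ k ω)
          + 1 / (2 * α k) * ‖c - x k ω‖ ^ 2 + Lφ * ‖c - x k ω‖)
        + 4 * α k ^ 2 * (L + Lφ) ^ 2 := by
  filter_upwards [H.ae_model_ge k, H.step k] with ω hge hstep c hc
  exact norm_sub_sq_le_of_isProxPoint (m := fun y => M (x k ω) y (ξ k ω)) (H.step_pos k) hstep hc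
    hge (H.reg_sub_le hc hstep.1) Lφ.2

theorem ae_norm_step_le (H : IsModelMethod D P U C f φ M τ η L Lφ α ξ x) (k : ℕ) :
    ∀ᵐ ω ∂P, ‖x (k + 2) ω - x (k + 1) ω‖ ≤ 2 * (L + Lφ) * α (k + 1) := by
  filter_upwards [H.ae_norm_step_sq_le (k + 1), H.succ_mem k] with ω hω hC
  have hle := hω _ hC
  have hα := H.step_pos (k + 1)
  have hL := H.lip_nonneg
  refine abs_le_of_sq_le_sq' (hle.trans_eq ?_) (by positivity) |>.2
  simp only [sub_self, norm_zero]
  ring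

theorem memLp_first_step (H : IsModelMethod D P U C f φ M τ η L Lφ α ξ x) :
    MemLp (fun ω => x 1 ω - x 0 ω) 2 P := by
  obtain ⟨a, ha⟩ : ∃ a, x 0 = fun _ => a :=
    stronglyMeasurable_bot_iff.1 (sampleHistory_zero ξ ▸ H.adapted 0).stronglyMeasurable
  obtain ⟨c, hc⟩ := H.nonempty
  have haU : a ∈ U := H.init_mem.exists.elim fun ω hω => congrFun ha ω ▸ hω
  have hint : ∀ y ∈ U, Integrable (fun ω => M a y (ξ 0 ω)) P := fun y hy =>
    ((H.law 0).symm ▸ H.integrable_model a haU y hy).comp_measurable (H.measurable_sample 0)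
  have hmeas : Measurable fun ω => x 1 ω - x 0 ω :=
    (H.measurable_iterate 1).sub (H.measurable_iterate 0)
  let g (ω : Ω) : ℝ := 4 * α 0 * (M a c (ξ 0 ω) - M a a (ξ 0 ω) + 1 / (2 * α 0) * ‖c - a‖ ^ 2
    + Lφ * ‖c - a‖) + 4 * α 0 ^ 2 * (L + Lφ) ^ 2
  have hg : Integrable g P :=
    (((((hint c (H.subset hc)).sub (hint a haU)).add (integrable_const _)).add
      (integrable_const _)).const_mul _).add (integrable_const _)
  refine (memLp_two_iff_integrable_sq_norm hmeas.aestronglyMeasurable).2 <|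
    hg.mono' (hmeas.norm.pow_const 2).aestronglyMeasurable ?_
  filter_upwards [H.ae_norm_step_sq_le 0] with ω hω
  rw [Real.norm_of_nonneg (by positivity)]
  simpa only [ha, zero_add] using hω c hc

theorem memLp_step (H : IsModelMethod D P U C f φ M τ η L Lφ α ξ x) :
    ∀ k, MemLp (fun ω => x (k + 1) ω - x k ω) 2 P
  | 0 => H.memLp_first_step
  | k + 1 => MemLp.of_bound
      ((H.measurable_iterate _).sub (H.measurable_iterate _)).aestronglyMeasurable _
      (H.ae_norm_step_le k)

theorem memLp_two (H : IsModelMethod D P U C f φ M τ η L Lφ α ξ x) (k : ℕ) :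
    MemLp (x k) 2 P := by
  induction k with
  | zero => exact memLp_of_measurable_bot (sampleHistory_zero ξ ▸ H.adapted 0).stronglyMeasurable
  | succ k ih =>
    simpa only [Pi.add_def, sub_add_cancel] using (H.memLp_step k).add ih

end NormedSpace

variable {E Ξ Ω : Type*} [NormedAddCommGroup E] [InnerProductSpace ℝ E] [FiniteDimensional ℝ E]
  [MeasurableSpace E] [BorelSpace E] [MeasurableSpace Ξ] [MeasurableSpace Ω] {D : Measure Ξ}
  {P : Measure Ω} [IsProbabilityMeasure D] [IsProbabilityMeasure P] {U C : Set E} {f φ : E → ℝ}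
  {M : E → E → Ξ → ℝ} {τ η L θ : ℝ} {Lφ : ℝ≥0} {α : ℕ → ℝ} {ξ : ℕ → Ω → Ξ} {x : ℕ → Ω → E}
  {p : E → E}

/-- The iterate depends on the sample, so growth at it cannot come from the minimality of a fixed
point: the inequality is measurable in `(x k, x (k + 1), ξ k)` once minimality is only tested along
a sequence of points of the segment. -/
theorem ae_quadratic_growth (H : IsModelMethod D P U C f φ M τ η L Lφ α ξ x) (hp : Measurable p)
    (hpC : ∀ z, p z ∈ C) (k : ℕ) :
    ∀ᵐ ω ∂P, proxValue (α k) (fun y => M (x k ω) y (ξ k ω) + φ y) (x k ω) (x (k + 1) ω)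
        + (1 / α k - η) / 2 * ‖x (k + 1) ω - p (x k ω)‖ ^ 2
      ≤ proxValue (α k) (fun y => M (x k ω) y (ξ k ω) + φ y) (x k ω) (p (x k ω)) := by
  obtain ⟨t, ht, ht_lim⟩ := exists_seq_mem_Ioc_tendsto_zero
  let F (q : E × E × Ξ) : ℝ := proxValue (α k) (fun y => M q.1 y q.2.2 + φ y) q.1 q.2.1
  have hF : Measurable F := by
    have := H.measurable_model
    have := H.measurable_reg
    unfold F proxValue
    fun_prop
  have hQ : MeasurableSet {q : E × E × Ξ |
      (∀ m, F q ≤ F (q.1, (1 - t m) • q.2.1 + t m • p q.1, q.2.2)) →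
        F q + (1 / α k - η) / 2 * ‖q.2.1 - p q.1‖ ^ 2 ≤ F (q.1, p q.1, q.2.2)} := by
    refine .imp ?_ (measurableSet_le (by fun_prop) (by fun_prop))
    rw [Set.ofPred_forall]
    exact .iInter fun m => measurableSet_le hF (by fun_prop)
  filter_upwards [H.step k, H.ae_mem_of_forall_ae hQ k fun a ha => by
    filter_upwards [H.model_weaklyConvex a ha] with s hs b hb hmin
    exact quadratic_growth_of_le_on_segment (hs.strongConvexOn_proxValue (α k) a) hb (hpC a) ht
      ht_lim hmin] with ω hstep hω
  exact hω fun m => hstep.2 <|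
    H.convex hstep.1 (hpC _) (sub_nonneg.2 (ht m).2) (ht m).1.le (sub_add_cancel 1 (t m))

theorem ae_norm_succ_sub_sq_le (H : IsModelMethod D P U C f φ M τ η L Lφ α ξ x)
    (hp : Measurable p) (hpC : ∀ z, p z ∈ C) (k : ℕ) :
    ∀ᵐ ω ∂P, x k ω ∈ C → (1 - α k * η) * ‖x (k + 1) ω - p (x k ω)‖ ^ 2
      ≤ ‖x k ω - p (x k ω)‖ ^ 2
        + 2 * α k * (M (x k ω) (p (x k ω)) (ξ k ω) - M (x k ω) (x k ω) (ξ k ω)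
          + (φ (p (x k ω)) - φ (x k ω)))
        + α k ^ 2 * (L + Lφ) ^ 2 := by
  filter_upwards [H.ae_quadratic_growth hp hpC k, H.ae_model_ge k, H.succ_mem k]
    with ω hgrowth hge hsucc hC
  have hreg := H.reg_sub_le hC hsucc
  have hα := H.step_pos k
  simp only [proxValue] at hgrowth
  rw [norm_sub_rev (p _)] at hgrowth
  rw [norm_sub_rev (x k ω) (x (k + 1) ω)] at hge hreg
  set r := ‖x (k + 1) ω - x k ω‖
  have hscaled := mul_le_mul_of_nonneg_left hgrowth (by positivity : 0 ≤ 2 * α k)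
  have hhalf : 2 * α k * (1 / (2 * α k)) = 1 := by field_simp
  have hone : α k * (1 / α k) = 1 := by field_simp
  have hdecrease : 2 * α k * (M (x k ω) (x k ω) (ξ k ω) + φ (x k ω) - (L + Lφ) * r)
      ≤ 2 * α k * (M (x k ω) (x (k + 1) ω) (ξ k ω) + φ (x (k + 1) ω)) := by
    gcongr
    linarith
  -- Completing the square absorbs the Lipschitz term: `2 α Λ r - r² ≤ α² Λ²`.
  linear_combination hscaled + hdecrease + sq_nonneg (r - α k * (L + Lφ))
    + (‖x k ω - p (x k ω)‖ ^ 2 - r ^ 2) * hhalf - ‖x (k + 1) ω - p (x k ω)‖ ^ 2 * hone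

theorem memLp_prox (H : IsModelMethod D P U C f φ M τ η L Lφ α ξ x)
    (hp : IsProxMap θ C (fun y => f y + φ y) p) (hθ : 0 < θ) (hρ : θ * (τ + η) < 1) (k : ℕ) :
    MemLp (fun ω => p (x k ω)) 2 P := by
  have hcont := hp.continuous H.weaklyConvexOn_objective hθ hρ
  have hdiff : MemLp (fun ω => p (x k ω) - p 0) 2 P :=
    (H.memLp_two k).of_le_mul
      ((hcont.measurable.comp (H.measurable_iterate k)).sub_const _).aestronglyMeasurable
      (.of_forall fun ω => by
        simpa only [sub_zero] using hp.norm_sub_le H.weaklyConvexOn_objective hθ hρ (x k ω) 0)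
  simpa only [Pi.add_def, sub_add_cancel] using hdiff.add (memLp_const (p 0))

theorem memLp_sub_prox (H : IsModelMethod D P U C f φ M τ η L Lφ α ξ x)
    (hp : IsProxMap θ C (fun y => f y + φ y) p) (hθ : 0 < θ) (hρ : θ * (τ + η) < 1) (k : ℕ) :
    MemLp (fun ω => x k ω - p (x k ω)) 2 P :=
  (H.memLp_two k).sub (H.memLp_prox hp hθ hρ k)

theorem integrable_gap_and_integral_gap_le (H : IsModelMethod D P U C f φ M τ η L Lφ α ξ x)
    (hp : IsProxMap θ C (fun y => f y + φ y) p) (hθ : 0 < θ) (hρ : θ * (τ + η) < 1) {k : ℕ}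
    (hxC : ∀ᵐ ω ∂P, x k ω ∈ C) :
    Integrable (fun ω => M (x k ω) (p (x k ω)) (ξ k ω) - M (x k ω) (x k ω) (ξ k ω)
        + (φ (p (x k ω)) - φ (x k ω))) P ∧
      ∫ ω, (M (x k ω) (p (x k ω)) (ξ k ω) - M (x k ω) (x k ω) (ξ k ω)
        + (φ (p (x k ω)) - φ (x k ω))) ∂P
      ≤ -(1 / θ - (τ + η) + η / 2) * ∫ ω, ‖x k ω - p (x k ω)‖ ^ 2 ∂P := by
  have hp_meas := (hp.continuous H.weaklyConvexOn_objective hθ hρ).measurable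
  have hM_meas := H.measurable_model
  have hφ_meas := H.measurable_reg
  have hgap := H.memLp_sub_prox hp hθ hρ k
  rw [← integral_const_mul]
  exact integrable_and_integral_le_of_indepFun
    (T := fun a s => M a (p a) s - M a a s + (φ (p a) - φ a))
    (B := fun a => -(1 / θ - (τ + η) + η / 2) * ‖a - p a‖ ^ 2)
    (ℓ := fun a => (L + Lφ) * ‖a - p a‖)
    (H.measurable_iterate k) (H.measurable_sample k) (H.indepFun_iterate_sample k) (H.law k)
    H.isClosed.measurableSet hxC (by fun_prop) (by fun_prop) (by fun_prop)
    ((hgap.integrable_norm_pow two_ne_zero).const_mul _)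
    ((hgap.integrable one_le_two).norm.const_mul _)
    (fun a ha => ((H.integrable_model a (H.subset ha) _ (H.subset (hp a).1)).sub
      (H.integrable_model a (H.subset ha) a (H.subset ha))).add (integrable_const _))
    (fun a ha => H.ae_neg_le_gap ha (hp a).1) (fun a ha => H.integral_gap_le hp ha)

theorem integral_norm_succ_sub_sq_le (H : IsModelMethod D P U C f φ M τ η L Lφ α ξ x)
    (hp : IsProxMap θ C (fun y => f y + φ y) p) (hθ : 0 < θ) (hρ : θ * (τ + η) < 1) (k : ℕ) :
    (1 - α (k + 1) * η) * ∫ ω, ‖x (k + 2) ω - p (x (k + 1) ω)‖ ^ 2 ∂P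
      ≤ (1 - α (k + 1) * η) * ∫ ω, ‖x (k + 1) ω - p (x (k + 1) ω)‖ ^ 2 ∂P
        - 2 * (α (k + 1) * (1 / θ - (τ + η)) * ∫ ω, ‖x (k + 1) ω - p (x (k + 1) ω)‖ ^ 2 ∂P)
        + α (k + 1) ^ 2 * (L + Lφ) ^ 2 := by
  have hp_meas := (hp.continuous H.weaklyConvexOn_objective hθ hρ).measurable
  have hsq := (H.memLp_sub_prox hp hθ hρ (k + 1)).integrable_norm_pow two_ne_zero
  obtain ⟨hint, hle⟩ := H.integrable_gap_and_integral_gap_le hp hθ hρ (H.succ_mem k)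
  have hmono := integral_mono_ae
    ((integrable_norm_sub_sq (H.memLp_two (k + 2)) (H.memLp_prox hp hθ hρ (k + 1))).const_mul _)
    ((hsq.add (hint.const_mul (2 * α (k + 1)))).add (integrable_const _)) <| by
      filter_upwards [H.ae_norm_succ_sub_sq_le hp_meas (fun z => (hp z).1) (k + 1), H.succ_mem k]
        with ω hω hC using hω hC
  rw [integral_const_mul, integral_add' (hsq.add (hint.const_mul _)) (integrable_const _),
    integral_add' hsq (hint.const_mul _), integral_const_mul, integral_const, probReal_univ,
    one_smul] at hmono
  have hscaled := mul_le_mul_of_nonneg_left hle (mul_pos two_pos (H.step_pos (k + 1))).le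
  linarith

theorem integrable_proxValue (H : IsModelMethod D P U C f φ M τ η L Lφ α ξ x)
    (hp : IsProxMap θ C (fun y => f y + φ y) p) (hθ : 0 < θ) (hρ : θ * (τ + η) < 1)
    {b : ℝ} (hb : ∀ y ∈ C, b ≤ f y + φ y) (k : ℕ) :
    Integrable (fun ω => proxValue θ (fun y => f y + φ y) (x k ω) (p (x k ω))) P := by
  obtain ⟨c, hc⟩ := H.nonempty
  have hcont : Continuous fun z => proxValue θ (fun y => f y + φ y) z (p z) :=
    continuous_iff_continuousAt.2 fun z =>
      (hp.hasGradientAt H.weaklyConvexOn_objective hθ hρ z).continuousAt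
  exact integrable_of_le_of_le
    (hcont.measurable.comp (H.measurable_iterate k)).aestronglyMeasurable
    (.of_forall fun ω => le_proxValue hθ (hb _ (hp (x k ω)).1))
    (.of_forall fun ω => (hp (x k ω)).2 hc) (integrable_const b)
    ((integrable_const _).add
      ((integrable_norm_sub_sq (memLp_const c) (H.memLp_two k)).const_mul _))

theorem integral_proxValue_succ_sub_le (H : IsModelMethod D P U C f φ M τ η L Lφ α ξ x)
    (hp : IsProxMap θ C (fun y => f y + φ y) p) (hθ : 0 < θ) (hρ : θ * (τ + η) < 1)
    {b : ℝ} (hb : ∀ y ∈ C, b ≤ f y + φ y) (k : ℕ) :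
    2 * θ * ∫ ω, proxValue θ (fun y => f y + φ y) (x (k + 1) ω) (p (x (k + 1) ω)) ∂P
        - 2 * θ * ∫ ω, proxValue θ (fun y => f y + φ y) (x k ω) (p (x k ω)) ∂P
      ≤ ∫ ω, ‖x (k + 1) ω - p (x k ω)‖ ^ 2 ∂P - ∫ ω, ‖x k ω - p (x k ω)‖ ^ 2 ∂P := by
  have henv := H.integrable_proxValue hp hθ hρ hb
  have hprox := H.memLp_prox hp hθ hρ k
  rw [← mul_sub, ← integral_sub (henv (k + 1)) (henv k), ← integral_const_mul,
    ← integral_sub (integrable_norm_sub_sq (H.memLp_two (k + 1)) hprox)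
      (integrable_norm_sub_sq (H.memLp_two k) hprox)]
  exact integral_mono (((henv (k + 1)).sub (henv k)).const_mul _)
    ((integrable_norm_sub_sq (H.memLp_two (k + 1)) hprox).sub
      (integrable_norm_sub_sq (H.memLp_two k) hprox))
    fun ω => hp.two_mul_proxValue_sub_le hθ (x k ω) (x (k + 1) ω)

theorem summable_integral_norm_sq (H : IsModelMethod D P U C f φ M τ η L Lφ α ξ x)
    (hp : IsProxMap θ C (fun y => f y + φ y) p) (hθ : 0 < θ) (hρ : θ * (τ + η) < 1)
    {b : ℝ} (hb : ∀ y ∈ C, b ≤ f y + φ y) (hα_sq : Summable fun k => α k ^ 2) :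
    Summable fun k => α k * ∫ ω, ‖x k ω - p (x k ω)‖ ^ 2 ∂P := by
  have hκ : 0 < 1 / θ - (τ + η) := by
    rw [sub_pos, lt_div_iff₀ hθ]
    linarith
  set κ := 1 / θ - (τ + η)
  have hd (k : ℕ) : 0 ≤ ∫ ω, ‖x k ω - p (x k ω)‖ ^ 2 ∂P := by positivity
  have hlower (k : ℕ) :
      2 * θ * b ≤ 2 * θ * ∫ ω, proxValue θ (fun y => f y + φ y) (x k ω) (p (x k ω)) ∂P := by
    gcongr
    simpa only [integral_const, probReal_univ, one_smul] using
      integral_mono (integrable_const b) (H.integrable_proxValue hp hθ hρ hb k)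
        fun ω => le_proxValue hθ (hb _ (hp (x k ω)).1)
  refine (summable_mul_left_iff (by positivity : 4 / 3 * κ ≠ 0)).1 <|
    summable_of_eventually_descent hlower
      (fun k => by have := H.step_pos k; have := hd k; positivity)
      (hα_sq.mul_left (2 * (L + Lφ) ^ 2)) ?_
  filter_upwards [eventually_abs_mul_le_half_of_summable_sq hα_sq η, eventually_ge_atTop 1]
    with k hsmall hk
  obtain ⟨j, rfl⟩ := Nat.exists_eq_add_of_le' hk
  have hrelaxed := sub_le_of_relaxed_contraction
    (mul_nonneg (mul_pos (H.step_pos (j + 1)) hκ).le (hd (j + 1))) (by positivity)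
    (abs_le.1 hsmall) (H.integral_norm_succ_sub_sq_le hp hθ hρ j)
  linarith [H.integral_proxValue_succ_sub_le hp hθ hρ hb (j + 1)]

theorem ae_abs_norm_sub_prox_succ_sub_le (H : IsModelMethod D P U C f φ M τ η L Lφ α ξ x)
    (hp : IsProxMap θ C (fun y => f y + φ y) p) (hθ : 0 < θ) (hρ : θ * (τ + η) < 1) (k : ℕ) :
    ∀ᵐ ω ∂P, |‖x (k + 2) ω - p (x (k + 2) ω)‖ - ‖x (k + 1) ω - p (x (k + 1) ω)‖|
      ≤ (1 + (1 - θ * (τ + η))⁻¹) * (2 * (L + Lφ)) * α (k + 1) := by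
  have : 0 ≤ (1 - θ * (τ + η))⁻¹ := inv_nonneg.2 (sub_pos.2 hρ).le
  filter_upwards [H.ae_norm_step_le k] with ω hω
  calc _ ≤ ‖(x (k + 2) ω - x (k + 1) ω) - (p (x (k + 2) ω) - p (x (k + 1) ω))‖ := by
        rw [sub_sub_sub_comm]
        exact abs_norm_sub_norm_le _ _
    _ ≤ ‖x (k + 2) ω - x (k + 1) ω‖
          + (1 - θ * (τ + η))⁻¹ * ‖x (k + 2) ω - x (k + 1) ω‖ :=
        (norm_sub_le _ _).trans <| by
          gcongr
          exact hp.norm_sub_le H.weaklyConvexOn_objective hθ hρ _ _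
    _ = (1 + (1 - θ * (τ + η))⁻¹) * ‖x (k + 2) ω - x (k + 1) ω‖ := by ring
    _ ≤ _ := by
        rw [mul_assoc]
        gcongr

theorem tendsto_integral_norm_sub_prox (H : IsModelMethod D P U C f φ M τ η L Lφ α ξ x)
    (hp : IsProxMap θ C (fun y => f y + φ y) p) (hθ : 0 < θ) (hρ : θ * (τ + η) < 1)
    {b : ℝ} (hb : ∀ y ∈ C, b ≤ f y + φ y) (hα_sum : ¬ Summable α)
    (hα_sq : Summable fun k => α k ^ 2) :
    Tendsto (fun k => ∫ ω, ‖x k ω - p (x k ω)‖ ∂P) atTop (𝓝 0) := by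
  have hgap := H.memLp_sub_prox hp hθ hρ
  refine tendsto_zero_of_summable_mul_sq (fun k => (H.step_pos k).le) hα_sq
    ((H.summable_integral_norm_sq hp hθ hρ hb hα_sq).of_nonneg_of_le
      (fun k => mul_nonneg (H.step_pos k).le (sq_nonneg _))
      fun k => mul_le_mul_of_nonneg_left (sq_integral_le_integral_sq (hgap k).norm)
        (H.step_pos k).le)
    (C := (1 + (1 - θ * (τ + η))⁻¹) * (2 * (L + Lφ))) ?_ hα_sum
  filter_upwards [eventually_ge_atTop 1] with k hk
  obtain ⟨j, rfl⟩ := Nat.exists_eq_add_of_le' hk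
  have hint (k : ℕ) := ((hgap k).integrable one_le_two).norm
  rw [← integral_sub (hint _) (hint _)]
  refine abs_integral_le_integral_abs.trans ?_
  simpa only [Pi.sub_apply, integral_const, probReal_univ, one_smul] using
    integral_mono_ae ((hint _).sub (hint _)).abs (integrable_const _)
      (H.ae_abs_norm_sub_prox_succ_sub_le hp hθ hρ j)

theorem ae_tendsto_norm_sub_prox (H : IsModelMethod D P U C f φ M τ η L Lφ α ξ x)
    (hp : IsProxMap θ C (fun y => f y + φ y) p) (hθ : 0 < θ) (hρ : θ * (τ + η) < 1)
    {b : ℝ} (hb : ∀ y ∈ C, b ≤ f y + φ y) (hα_sum : ¬ Summable α)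
    (hα_sq : Summable fun k => α k ^ 2) :
    ∀ᵐ ω ∂P, Tendsto (fun k => ‖x k ω - p (x k ω)‖) atTop (𝓝 0) := by
  have hnorm (k : ℕ) (ω : Ω) : ‖α k * ‖x k ω - p (x k ω)‖ ^ 2‖ = α k * ‖x k ω - p (x k ω)‖ ^ 2 :=
    Real.norm_of_nonneg (mul_nonneg (H.step_pos k).le (sq_nonneg _))
  have hsum := ae_summable_norm_of_summable_integral_norm (P := P)
    (g := fun k ω => α k * ‖x k ω - p (x k ω)‖ ^ 2)
    (fun k => ((H.memLp_sub_prox hp hθ hρ k).integrable_norm_pow two_ne_zero).const_mul _)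
    (by simpa only [hnorm, integral_const_mul] using
      H.summable_integral_norm_sq hp hθ hρ hb hα_sq)
  filter_upwards [hsum, ae_all_iff.2 (H.ae_abs_norm_sub_prox_succ_sub_le hp hθ hρ)]
    with ω hω hstep
  refine tendsto_zero_of_summable_mul_sq (fun k => (H.step_pos k).le) hα_sq
    (by simpa only [hnorm] using hω)
    (C := (1 + (1 - θ * (τ + η))⁻¹) * (2 * (L + Lφ))) ?_ hα_sum
  filter_upwards [eventually_ge_atTop 1] with k hk
  obtain ⟨j, rfl⟩ := Nat.exists_eq_add_of_le' hk
  exact hstep j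

end IsModelMethod

/-! ### Convergence of the Moreau envelope -/

theorem exists_measurable_model_eqOn {E Ξ : Type*} [MeasurableSpace E] [MeasurableSpace Ξ]
    {U : Set E} (hU : MeasurableSet U) (hne : U.Nonempty) {M : E → E → Ξ → ℝ}
    (hM : Measurable fun q : U × U × Ξ => M q.1 q.2.1 q.2.2) :
    ∃ M' : E → E → Ξ → ℝ, (Measurable fun q : E × E × Ξ => M' q.1 q.2.1 q.2.2) ∧
      ∀ a ∈ U, ∀ b ∈ U, M' a b = M a b := by
  obtain ⟨r, hr, hrU⟩ := hU.exists_measurable_proj hne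
  refine ⟨fun a b => M (r a) (r b), hM.comp (by fun_prop : Measurable fun q : E × E × Ξ =>
    (r q.1, r q.2.1, q.2.2)), fun a ha b hb => ?_⟩
  simp only [show r a = ⟨a, ha⟩ from hrU ⟨a, ha⟩, show r b = ⟨b, hb⟩ from hrU ⟨b, hb⟩]

theorem exists_isStochasticModel {E Ξ : Type*} [NormedAddCommGroup E] [NormedSpace ℝ E]
    [MeasurableSpace E] [BorelSpace E] [MeasurableSpace Ξ] {D : Measure Ξ}
    [IsProbabilityMeasure D] {f : E → ℝ} {φ : E → EReal} {U : Set E} (hU : MeasurableSet U)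
    (hφU : effDom φ ⊆ U) (hφ_proper : IsProperFun φ) (hφ_lsc : LowerSemicontinuous φ)
    {M : E → E → Ξ → ℝ} (hM_meas : Measurable fun q : U × U × Ξ => M q.1 q.2.1 q.2.2)
    {τ η L : ℝ} {Lφ : ℝ≥0} (hM_int : ∀ x ∈ U, ∀ y ∈ U, Integrable (M x y) D)
    (hM_acc : ∀ x ∈ U, ∫ s, M x x s ∂D = f x)
    (hM_one : ∀ x ∈ U, ∀ y ∈ U, ∫ s, (M x y s - f y) ∂D ≤ τ / 2 * ‖x - y‖ ^ 2)
    (hM_wc : ∀ x ∈ U, ∀ᵐ s ∂D, WeaklyConvex η fun y => (M x y s : EReal) + φ y)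
    (hL : 0 ≤ L) (hM_lip : ∀ x ∈ U, ∀ y ∈ U, ∀ᵐ s ∂D, M x x s - M x y s ≤ L * ‖x - y‖)
    (hφ_lip : LipschitzOnWith Lφ (fun x => (φ x).toReal) (effDom φ)) :
    ∃ M' : E → E → Ξ → ℝ, (∀ a ∈ U, ∀ b ∈ U, M' a b = M a b) ∧
      IsStochasticModel D U (effDom φ) f (fun y => (φ y).toReal) M' τ η L Lφ := by
  obtain ⟨M', hM'_meas, hM'⟩ :=
    exists_measurable_model_eqOn hU (hφ_proper.2.mono hφU) hM_meas
  refine ⟨M', hM', {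
    measurableSet := hU
    subset := hφU
    isClosed := isClosed_effDom_of_lipschitzOnWith hφ_proper.1 hφ_lsc hφ_lip
    nonempty := hφ_proper.2
    measurable_reg := hφ_lsc.measurable.ereal_toReal
    lipschitz_reg := hφ_lip
    measurable_model := hM'_meas
    integrable_model := fun a ha b hb => hM' a ha b hb ▸ hM_int a ha b hb
    model_self := fun a ha => hM' a ha a ha ▸ hM_acc a ha
    model_le := fun a ha b hb => ?_
    model_weaklyConvex := fun a ha => ?_
    lip_nonneg := hL
    model_lip := fun a ha b hb => hM' a ha a ha ▸ hM' a ha b hb ▸ hM_lip a ha b hb }⟩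
  · have hle := hM_one a ha b hb
    rw [integral_sub (hM_int a ha b hb) (integrable_const _), integral_const, probReal_univ,
      one_smul] at hle
    rw [hM' a ha b hb]
    linarith
  · filter_upwards [hM_wc a ha] with s hs
    exact ConvexOn.congr (hs.weaklyConvexOn_add_toReal hφ_proper.1) fun y hy => by
      simp only [hM' a ha y (hφU hy)]

theorem corollary3p10_general {E : Type*} [NormedAddCommGroup E] [InnerProductSpace ℝ E]
    [FiniteDimensional ℝ E] [MeasurableSpace E] [BorelSpace E]
    {Ξ : Type*} [MeasurableSpace Ξ] (D : Measure Ξ) [IsProbabilityMeasure D]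
    {Ω : Type*} [MeasurableSpace Ω] (P : Measure Ω) [IsProbabilityMeasure P]
    (f : E → ℝ) (φ : E → EReal) (U : Set E) (hU : MeasurableSet U) (hφU : effDom φ ⊆ U)
    (hφ_proper : IsProperFun φ) (hφ_lsc : LowerSemicontinuous φ)
    (hψ_lb : ∃ b : ℝ, ∀ x ∈ effDom φ, (b : EReal) ≤ f x + φ x)
    (M : E → E → Ξ → ℝ) (hM_meas : Measurable fun q : U × U × Ξ => M q.1 q.2.1 q.2.2)
    (τ η L : ℝ) (Lφ : ℝ≥0) (hM_int : ∀ x ∈ U, ∀ y ∈ U, Integrable (M x y) D)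
    (hM_acc : ∀ x ∈ U, ∫ s, M x x s ∂D = f x)
    (hM_one : ∀ x ∈ U, ∀ y ∈ U, ∫ s, (M x y s - f y) ∂D ≤ τ / 2 * ‖x - y‖ ^ 2)
    (hM_wc : ∀ x ∈ U, ∀ᵐ s ∂D, WeaklyConvex η fun y => (M x y s : EReal) + φ y)
    (hL : 0 ≤ L) (hM_lip : ∀ x ∈ U, ∀ y ∈ U, ∀ᵐ s ∂D, M x x s - M x y s ≤ L * ‖x - y‖)
    (hφ_lip : LipschitzOnWith Lφ (fun x => (φ x).toReal) (effDom φ))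
    (α : ℕ → ℝ) (hα_pos : ∀ k, 0 < α k)
    (hα_sum : Tendsto (fun K => ∑ k ∈ Finset.range K, α k) atTop atTop)
    (hα_sq : Summable fun k => α k ^ 2)
    (ξ : ℕ → Ω → Ξ) (hξ_meas : ∀ k, Measurable (ξ k)) (hξ_indep : iIndepFun ξ P)
    (hξ_law : ∀ k, P.map (ξ k) = D)
    (x : ℕ → Ω → E) (hx_adapted : ∀ k, Measurable[sampleHistory ξ k] (x k))
    (hx_init : ∀ᵐ ω ∂P, x 0 ω ∈ U)
    (hx_step : ∀ k, ∀ᵐ ω ∂P,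
      IsMinOn (proxObjective (α k) (fun y => (M (x k ω) y (ξ k ω) : EReal) + φ y) (x k ω))
        Set.univ (x (k + 1) ω))
    (θ : ℝ) (hθ_pos : 0 < θ) (hθ : θ * (τ + η) < 1) :
    (∀ z, ∃ y, IsMinOn (proxObjective θ (fun y => (f y : EReal) + φ y) z) Set.univ y ∧
      proxObjective θ (fun y => (f y : EReal) + φ y) z y
        = (moreauEnv θ (fun y => (f y : EReal) + φ y) z : EReal)) ∧
    Differentiable ℝ (moreauEnv θ fun y => (f y : EReal) + φ y) ∧
    (∀ k, Integrable
      (fun ω => ‖gradient (moreauEnv θ fun y => (f y : EReal) + φ y) (x k ω)‖) P) ∧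
    Tendsto (fun k => ∫ ω, ‖gradient (moreauEnv θ fun y => (f y : EReal) + φ y) (x k ω)‖ ∂P)
      atTop (𝓝 0) ∧
    ∀ᵐ ω ∂P, Tendsto (fun k => ‖gradient (moreauEnv θ fun y => (f y : EReal) + φ y) (x k ω)‖)
      atTop (𝓝 0) := by
  obtain ⟨M', hM', hmodel⟩ := exists_isStochasticModel hU hφU hφ_proper hφ_lsc hM_meas hM_int
    hM_acc hM_one hM_wc hL hM_lip hφ_lip
  have hmem : ∀ k, ∀ᵐ ω ∂P, x k ω ∈ U
    | 0 => hx_init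
    | k + 1 => (hx_step k).mono fun ω h =>
        hφU ((isMinOn_proxObjective_coe_add_iff hφ_proper).1 h).1
  have H : IsModelMethod D P U (effDom φ) f (fun y => (φ y).toReal) M' τ η L Lφ α ξ x :=
    { hmodel with
      step_pos := hα_pos
      measurable_sample := hξ_meas
      indep := hξ_indep
      law := hξ_law
      adapted := hx_adapted
      init_mem := hx_init
      step := fun k => by
        filter_upwards [hx_step k, hmem k] with ω hmin hω
        exact ((isMinOn_proxObjective_coe_add_iff hφ_proper).1 hmin).congr fun y hy => by
          simp only [hM' _ hω y (hφU hy)] }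
  obtain ⟨b, hb⟩ : ∃ b : ℝ, ∀ y ∈ effDom φ, b ≤ f y + (φ y).toReal :=
    hψ_lb.imp fun b hb y hy =>
      EReal.coe_le_coe_iff.1 (coe_add_eq_coe hφ_proper.1 hy (f y) ▸ hb y hy)
  obtain ⟨p, hp⟩ := H.exists_isProxMap hθ_pos hb
  have hgrad := hp.hasGradientAt_moreauEnv hφ_proper H.weaklyConvexOn_objective hθ_pos hθ
  have hα_not := (not_summable_iff_tendsto_nat_atTop_of_nonneg fun k => (hα_pos k).le).2 hα_sum
  simp only [(hgrad _).gradient, norm_smul, integral_const_mul]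
  refine ⟨fun z => ⟨p z, (isMinOn_proxObjective_coe_add_iff hφ_proper).2 (hp z), ?_⟩,
    fun z => (hgrad z).differentiableAt, fun k => ?_, ?_, ?_⟩
  · rw [hp.moreauEnv_eq hφ_proper, proxObjective_coe_add hφ_proper.1 (hp z).1]
  · exact ((H.memLp_sub_prox hp hθ_pos hθ k).integrable one_le_two).norm.const_mul _
  · simpa only [mul_zero] using
      (H.tendsto_integral_norm_sub_prox hp hθ_pos hθ hb hα_not hα_sq).const_mul ‖1 / θ‖
  · filter_upwards [H.ae_tendsto_norm_sub_prox hp hθ_pos hθ hb hα_not hα_sq] with ω hω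
    simpa only [mul_zero] using hω.const_mul ‖1 / θ‖

theorem corollary3p10 {n : ℕ}
    {Ξ : Type*} [MeasurableSpace Ξ] (D : Measure Ξ) [IsProbabilityMeasure D]
    {Ω : Type*} [MeasurableSpace Ω] (P : Measure Ω) [IsProbabilityMeasure P]
    -- the problem data: samples `F (x, s)` of `f`, the regularizer `φ`, the open convex set `U`
    (F : EuclideanSpace ℝ (Fin n) → Ξ → ℝ) (φ : EuclideanSpace ℝ (Fin n) → EReal)
    (U : Set (EuclideanSpace ℝ (Fin n))) (hUo : IsOpen U) (hUc : Convex ℝ U)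
    (hφU : effDom φ ⊆ U)
    (hF : ∀ x ∈ U, Integrable (F x) D)
    (hf_wc : ∃ ρ : ℝ, WeaklyConvexOn ρ U (fun x => ∫ s, F x s ∂D))
    (hφ_wc : ∃ ρ : ℝ, WeaklyConvex ρ φ)
    (hφ_proper : IsProperFun φ) (hφ_lsc : LowerSemicontinuous φ)
    (hψ_lb : ∃ b : ℝ, ∀ x ∈ effDom φ, (b : EReal) ≤ compositeObjective D F φ x)
    -- the stochastic model functions `M x y s = f_x(y, s)`
    (M : EuclideanSpace ℝ (Fin n) → EuclideanSpace ℝ (Fin n) → Ξ → ℝ)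
    (hM_meas : Measurable (fun p : U × U × Ξ => M p.1 p.2.1 p.2.2))
    (τ η L : ℝ) (Lφ : ℝ≥0)
    -- one-sided accuracy
    (hM_int : ∀ x ∈ U, ∀ y ∈ U, Integrable (M x y) D)
    (hM_acc : ∀ x ∈ U, ∫ s, M x x s ∂D = ∫ s, F x s ∂D)
    (hM_one : ∀ x ∈ U, ∀ y ∈ U,
      ∫ s, (M x y s - ∫ s', F y s' ∂D) ∂D ≤ τ / 2 * ‖x - y‖ ^ 2)
    -- weak convexity of the model plus the regularizer
    (hM_wc : ∀ x ∈ U, ∀ᵐ s ∂D, WeaklyConvex η (fun y => (M x y s : EReal) + φ y))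
    -- one-sided Lipschitz property of the model
    (hL : 0 < L)
    (hM_lip : ∀ x ∈ U, ∀ y ∈ U, ∀ᵐ s ∂D, M x x s - M x y s ≤ L * ‖x - y‖)
    -- Lipschitz continuity of the regularizer on its domain
    (hφ_lip : LipschitzOnWith Lφ (fun x => (φ x).toReal) (effDom φ))
    -- step sizes
    (α : ℕ → ℝ) (hα_pos : ∀ k, 0 < α k)
    (hα_sum : Tendsto (fun K => ∑ k ∈ Finset.range K, α k) atTop atTop)
    (hα_sq : Summable (fun k => α k ^ 2))
    -- independent samples with distribution `D`
    (ξ : ℕ → Ω → Ξ) (hξ_meas : ∀ k, Measurable (ξ k)) (hξ_indep : iIndepFun ξ P)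
    (hξ_law : ∀ k, P.map (ξ k) = D)
    -- the iterates: adapted, started in `U`, each one a minimizer of the regularized model
    (x : ℕ → Ω → EuclideanSpace ℝ (Fin n))
    (hx_adapted : ∀ k, Measurable[sampleHistory ξ k] (x k))
    (hx_init : ∀ ω, x 0 ω ∈ U)
    (hx_step : ∀ k, ∀ᵐ ω ∂P,
      IsMinOn (proxObjective (α k) (fun y => (M (x k ω) y (ξ k ω) : EReal) + φ y) (x k ω))
        Set.univ (x (k + 1) ω))
    -- the parameter of the Moreau envelope
    (θ : ℝ) (hθ_pos : 0 < θ) (hθ : θ * (τ + η) < 1) :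
    -- the envelope is well defined (a finite, attained minimum) and differentiable
    (∀ z, ∃ y, IsMinOn (proxObjective θ (compositeObjective D F φ) z) Set.univ y ∧
      proxObjective θ (compositeObjective D F φ) z y
        = (moreauEnv θ (compositeObjective D F φ) z : EReal)) ∧
    Differentiable ℝ (moreauEnv θ (compositeObjective D F φ)) ∧
    -- convergence in expectation
    (∀ k, Integrable
      (fun ω => ‖gradient (moreauEnv θ (compositeObjective D F φ)) (x k ω)‖) P) ∧
    Tendsto
      (fun k => ∫ ω, ‖gradient (moreauEnv θ (compositeObjective D F φ)) (x k ω)‖ ∂P)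
      atTop (𝓝 0) ∧
    -- almost sure convergence
    ∀ᵐ ω ∂P, Tendsto
      (fun k => ‖gradient (moreauEnv θ (compositeObjective D F φ)) (x k ω)‖)
      atTop (𝓝 0) :=
  corollary3p10_general D P (fun y => ∫ s, F y s ∂D) φ U hUo.measurableSet hφU hφ_proper hφ_lsc
    hψ_lb M hM_meas τ η L Lφ hM_int hM_acc hM_one hM_wc hL.le hM_lip hφ_lip α hα_pos hα_sum hα_sq
    ξ hξ_meas hξ_indep hξ_law x hx_adapted (.of_forall hx_init) hx_step θ hθ_pos hθ
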